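/- **Setting.** Let $M$ be a smooth $5$-manifold with a volume form $\Omega$, let $B$ be a smooth $2$-manifold with an area form $\omega$, and let $\pi:M\to B$ be a smooth surjective submersion with vertical subbundle $\mathbb V=\ker d\pi$. Let $\gamma:TM\to\mathbb V$ be an Ehresmann connection ($\gamma|_{\mathbb V}=\mathrm{id}$) with horizontal subbundle $\mathbb H=\ker\gamma$, let $\kappa\in C^\infty(M)$, and let $\beta$ be a smooth $1$-form on $M$ vanishing on $\mathbb H$. The splitting $TM=\mathbb H\oplus\mathbb V$ induces a bigrading of forms and multivector fields (the bidegree $(p,q)$ counts horizontal and vertical degrees) and a decomposition $d=d_{1,0}+d_{0,1}+d_{2,-1}$ of the exterior differential. Interior products follow the rules $\mathbf i_{X\wedge Y}=\mathbf i_X\circ\mathbf i_Y$ and $\mathbf i_{\alpha\wedge\alpha'}=\mathbf i_\alpha\circ\mathbf i_{\alpha'}$. Let $\psi$ be the bivector field on $B$ with $\mathbf i_\psi\omega=-1$ and $\mathrm{hor}^\gamma\psi$ its horizontal lift. Let $\Omega^{\mathrm H}=\pi^*\omega$, let $\Omega^{\mathrm V}$ be the unique $3$-form of bidegree $(0,3)$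 with $\Omega=\Omega^{\mathrm H}\wedge\Omega^{\mathrm V}$, and let $Q_{\mathrm H}\in\Gamma\wedge^2\mathbb H$ and $Q_{\mathrm V}\in\Gamma\wedge^3\mathbb V$ be determined by $\mathbf i_{Q_{\mathrm H}}\Omega^{\mathrm H}=1$ and $\mathbf i_{Q_{\mathrm V}}\Omega^{\mathrm V}=1$. Put $$\theta=-\mathbf i_{Q_{\mathrm V}}d_{1,0}\Omega^{\mathrm V},\qquad \varrho=\mathbf i_{Q_{\mathrm H}}d_{2,-1}\Omega^{\mathrm V},\qquad \Pi=\kappa\,\mathrm{hor}^\gamma\psi-\mathbf i_\beta Q_{\mathrm V}.$$ Suppose that $(\gamma,\kappa,\beta)$ is a Poisson triple, i.e. $$d_{0,1}\beta\wedge\beta=0,\qquad \kappa\,(d_{1,0}\beta-\theta\wedge\beta)=0,\qquad d_{0,1}\kappa\wedge\beta-\kappa^2\varrho=0.$$ **Lemma.** There is exactly one smooth vector field $Z^\Omega$ on $M$ (the modular vector field of $\Pi$ relative to $\Omega$) such that $L_{Z^\Omega}f=\mathrm{div}_\Omega(\mathbf i_{df}\Pi)$ for all $f\in C^\infty(M)$.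 It has the bigraded decomposition $Z^\Omega=Z^\Omega_{1,0}+Z^\Omega_{0,1}$ with horizontal part $$Z^\Omega_{1,0}=-\mathbf i_{\kappa\theta+d_{1,0}\kappa}\,\mathrm{hor}^\gamma\psi\ \in\ \Gamma\mathbb H$$ and vertical part $$Z^\Omega_{0,1}=\mathbf i_{d_{0,1}\beta+\kappa\varrho}\,Q_{\mathrm V}\ \in\ \Gamma\mathbb V.$$ -/

import Mathlib

open scoped Manifold ContDiff

noncomputable section

namespace AlmostCoupling

/-! ### Linear algebra of forms and multivectors -/

/-- The model space of an `n`-manifold. By Mathlib's definition of `TangentSpace`, it is also the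
tangent space at each point of a manifold modelled on it. -/
abbrev Vec (n : ℕ) : Type := EuclideanSpace ℝ (Fin n)

/-- Covectors. -/
abbrev CoVec (n : ℕ) : Type := Vec n →L[ℝ] ℝ

/-- Alternating `k`-forms on one tangent space. -/
abbrev Alt (n k : ℕ) : Type := Vec n [⋀^Fin k]→L[ℝ] ℝ

/-- `k`-vectors at one point, as alternating `k`-linear functions of covectors; a decomposable
`k`-vector is `(X₁ ∧ … ∧ X_k)(a₁, …, a_k) = det (a_i(X_j))`. -/
abbrev MultiVec (n k : ℕ) : Type := CoVec n [⋀^Fin k]→L[ℝ] ℝ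

/-- The standard basis vectors of the tangent space. -/
def basisVec {n : ℕ} (i : Fin n) : Vec n := EuclideanSpace.single i 1

/-- The dual basis. -/
def basisCoVec {n : ℕ} (i : Fin n) : CoVec n := EuclideanSpace.proj i

/-- The vector of a `1`-vector. -/
def toVec {n : ℕ} (Q : MultiVec n 1) : Vec n :=
  ∑ i, Q (fun _ => basisCoVec i) • basisVec i

/-- `iterInt k X a = i_{X 0} (i_{X 1} (… (i_{X (k-1)} a)))`, where `i_x` inserts `x` into the first
slot. -/
def iterInt {V : Type*} [NormedAddCommGroup V] [NormedSpace ℝ V] {l : ℕ} :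
    (k : ℕ) → (Fin k → V) → V [⋀^Fin (l + k)]→L[ℝ] ℝ → V [⋀^Fin l]→L[ℝ] ℝ
  | 0, _, a => a
  | k + 1, X, a =>
    iterInt k (fun i => X i.castSucc)
      (ContinuousAlternatingMap.curryLeft (n := l + k) a (X (Fin.last k)))

/-- The interior product `i_Q a` of a `k`-vector `Q` and a form `a`: it is linear in `Q`, and
`i_{X₁ ∧ … ∧ X_k} = i_{X₁} ∘ … ∘ i_{X_k}`. -/
def intMulti {n k l : ℕ} (Q : MultiVec n k) (a : Alt n (l + k)) : Alt n l :=
  (k.factorial : ℝ)⁻¹ • ∑ J : Fin k → Fin n,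
    Q (fun i => basisCoVec (J i)) • iterInt k (fun i => basisVec (J i)) a

/-- The interior product `i_a Q` of a `k`-form `a` and a multivector `Q`: it is linear in `a`, and
`i_{a₁ ∧ … ∧ a_k} = i_{a₁} ∘ … ∘ i_{a_k}`. -/
def intForm {n k l : ℕ} (a : Alt n k) (Q : MultiVec n (l + k)) : MultiVec n l :=
  (k.factorial : ℝ)⁻¹ • ∑ J : Fin k → Fin n,
    a (fun i => basisVec (J i)) • iterInt k (fun i => basisCoVec (J i)) Q

/-- The push-forward of a multivector by a linear map. -/
def pushMulti {n m k : ℕ} (L : Vec m →L[ℝ] Vec n) (Q : MultiVec m k) : MultiVec n k :=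
  Q.compContinuousLinearMap (ContinuousLinearMap.precomp ℝ L)

/-- The wedge product as an algebraic alternating map (sum over shuffles, without factor). -/
def wedgeAlg {n k l : ℕ} (a : Alt n k) (b : Alt n l) : Vec n [⋀^Fin (k + l)]→ₗ[ℝ] ℝ :=
  ((LinearMap.mul' ℝ ℝ).compAlternatingMap
    (a.toAlternatingMap.domCoprod b.toAlternatingMap)).domDomCongr finSumFinEquiv

theorem wedgeAlg_continuous {n k l : ℕ} (a : Alt n k) (b : Alt n l) :
    Continuous (wedgeAlg a b) := by
  have h : ∀ v : Fin (k + l) → Vec n, wedgeAlg a b v =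
      ∑ σ : Equiv.Perm.ModSumCongr (Fin k) (Fin l), LinearMap.mul' ℝ ℝ
        (AlternatingMap.domCoprod.summand a.toAlternatingMap b.toAlternatingMap σ
          (fun i => v (finSumFinEquiv i))) := by
    intro v
    simp only [wedgeAlg, AlternatingMap.domDomCongr_apply, LinearMap.compAlternatingMap_apply,
      AlternatingMap.domCoprod_apply, sum_apply, map_sum]
    rfl
  rw [show (⇑(wedgeAlg a b)) = _ from funext h]
  refine continuous_finsetSum _ fun σ _ => ?_
  induction σ using Quotient.inductionOn' with
  | _ σ =>
    have h2 : ∀ v : Fin (k + l) → Vec n, LinearMap.mul' ℝ ℝ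
        (AlternatingMap.domCoprod.summand a.toAlternatingMap b.toAlternatingMap
          (Quotient.mk'' σ) (fun i => v (finSumFinEquiv i))) =
        ((Equiv.Perm.sign σ : ℤ) : ℝ) * (a (fun i => v (finSumFinEquiv (σ (Sum.inl i)))) *
          b (fun i => v (finSumFinEquiv (σ (Sum.inr i))))) := by
      intro v
      rw [AlternatingMap.domCoprod.summand_mk'']
      have h3 : LinearMap.mul' ℝ ℝ (((MultilinearMap.domCoprod
          (a.toAlternatingMap : MultilinearMap ℝ (fun _ : Fin k => Vec n) ℝ)
          (b.toAlternatingMap : MultilinearMap ℝ (fun _ : Fin l => Vec n) ℝ)).domDomCongr σ)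
          (fun i => v (finSumFinEquiv i))) =
          a (fun i => v (finSumFinEquiv (σ (Sum.inl i)))) *
            b (fun i => v (finSumFinEquiv (σ (Sum.inr i)))) := rfl
      rw [← h3]
      rcases Int.units_eq_one_or (Equiv.Perm.sign σ) with h4 | h4 <;> rw [h4]
      · rw [one_smul]; simp only [Units.val_one, Int.cast_one, one_mul]
      · rw [Units.neg_smul, one_smul, neg_apply, map_neg]
        simp only [Units.val_neg, Units.val_one, Int.cast_neg, Int.cast_one, neg_mul, one_mul]
    rw [funext h2]
    refine continuous_const.mul (Continuous.mul ?_ ?_)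
    · exact a.cont.comp (by fun_prop)
    · exact b.cont.comp (by fun_prop)

/-- The wedge product of forms. -/
def wedge {n k l : ℕ} (a : Alt n k) (b : Alt n l) : Alt n (k + l) :=
  { wedgeAlg a b with cont := wedgeAlg_continuous a b }

/-- The multilinear map `a` with `1 - g` applied in the slots in `S` and `g` in the others. -/
def partComp {n k : ℕ} (g : Vec n →L[ℝ] Vec n) (S : Finset (Fin k)) (a : Alt n k) :
    ContinuousMultilinearMap ℝ (fun _ : Fin k => Vec n) ℝ :=
  a.toContinuousMultilinearMap.compContinuousLinearMap
    (fun i => if i ∈ S then ContinuousLinearMap.id ℝ (Vec n) - g else g)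

theorem partComp_sum_eq_zero {n k : ℕ} (g : Vec n →L[ℝ] Vec n) (p : ℕ) (a : Alt n k)
    (v : Fin k → Vec n) (i j : Fin k) (hv : v i = v j) (hij : i ≠ j) :
    (∑ S ∈ Finset.powersetCard p (Finset.univ : Finset (Fin k)), partComp g S a) v = 0 := by
  rw [sum_apply]
  have hsw : ∀ m, v (Equiv.swap i j m) = v m := fun m => by
    by_cases h1 : m = i
    · subst h1; simp [hv]
    · by_cases h2 : m = j
      · subst h2; simp [hv]
      · rw [Equiv.swap_apply_of_ne_of_ne h1 h2]
  have key : ∀ S : Finset (Fin k),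
      partComp g (S.map (Equiv.swap i j).toEmbedding) a v = - partComp g S a v := by
    intro S
    have := a.map_swap (v := fun m => (if m ∈ S then ContinuousLinearMap.id ℝ (Vec n) - g else g)
      (v m)) hij
    simp only [partComp, ContinuousMultilinearMap.compContinuousLinearMap_apply]
    refine Eq.trans ?_ this
    change a _ = a _
    congr 1
    funext m
    have hm : (m ∈ S.map (Equiv.swap i j).toEmbedding) ↔ Equiv.swap i j m ∈ S := by
      rw [Finset.mem_map_equiv, Equiv.symm_swap]
    simp only [Function.comp, hsw, hm]
  have h2 : ∑ S ∈ Finset.powersetCard p (Finset.univ : Finset (Fin k)), partComp g S a v =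
      ∑ S ∈ Finset.powersetCard p (Finset.univ : Finset (Fin k)), - partComp g S a v := by
    refine Finset.sum_bij' (fun S _ => S.map (Equiv.swap i j).toEmbedding)
      (fun S _ => S.map (Equiv.swap i j).toEmbedding) ?_ ?_ ?_ ?_ ?_
    · intro S hS; simpa [Finset.mem_powersetCard] using hS
    · intro S hS; simpa [Finset.mem_powersetCard] using hS
    · intro S _; ext x; simp [Finset.mem_map_equiv]
    · intro S _; ext x; simp [Finset.mem_map_equiv]
    · intro S _; rw [key]; simp
  rw [Finset.sum_neg_distrib] at h2
  linarith

/-- The component of bidegree `(p, k - p)` of the `k`-form `a`, for the splitting of the tangent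
space into `ker g` (horizontal) and `range g` (vertical), where `g` is a projection. It is `0` if
`p > k`. -/
def comp {n k : ℕ} (g : Vec n →L[ℝ] Vec n) (p : ℕ) (a : Alt n k) : Alt n k :=
  { ∑ S ∈ Finset.powersetCard p (Finset.univ : Finset (Fin k)), partComp g S a with
    map_eq_zero_of_eq' := fun v i j hv hij => partComp_sum_eq_zero g p a v i j hv hij }

/-! ### Forms and vector fields on manifolds -/

section Manifold

variable {n : ℕ} {M : Type*} [TopologicalSpace M] [ChartedSpace (EuclideanSpace ℝ (Fin n)) M]

/-- (Not necessarily smooth) `k`-forms on an `n`-manifold `M`; the value at `p` is an alternating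
form on `TangentSpace (𝓡 n) p`, which is `Vec n` by definition. -/
abbrev Form (n : ℕ) (M : Type*) (k : ℕ) := M → Alt n k

/-- (Not necessarily smooth) `k`-vector fields. -/
abbrev MultiField (n : ℕ) (M : Type*) (k : ℕ) := M → MultiVec n k

/-- (Not necessarily smooth) vector fields. -/
abbrev Field (n : ℕ) (M : Type*) := M → Vec n

/-- The representation of a form in the preferred chart at `p`. -/
def inChart {k : ℕ} (α : Form n M k) (p : M) (y : Vec n) : Alt n k :=
  (α ((extChartAt (𝓡 n) p).symm y)).compContinuousLinearMap
    (mfderiv 𝓘(ℝ, EuclideanSpace ℝ (Fin n)) (𝓡 n) (extChartAt (𝓡 n) p).symm y : Vec n →L[ℝ] Vec n)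

/-- Smoothness of a form: its representation in every preferred chart is smooth. -/
def SmoothForm {k : ℕ} (α : Form n M k) : Prop :=
  ∀ p : M, ContDiffOn ℝ ∞ (inChart α p) (extChartAt (𝓡 n) p).target

/-- Smoothness of a vector field. -/
def SmoothField [IsManifold (𝓡 n) ∞ M] (X : Field n M) : Prop :=
  ContMDiff (𝓡 n) (𝓡 n).tangent ∞ (fun p => (⟨p, X p⟩ : TangentBundle (𝓡 n) M))

/-- Smoothness of a field of endomorphisms of the tangent spaces. -/
def SmoothEndo [IsManifold (𝓡 n) ∞ M] (g : M → Vec n →L[ℝ] Vec n) : Prop :=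
  ContMDiff (𝓡 n) ((𝓡 n).prod 𝓘(ℝ, EuclideanSpace ℝ (Fin n) →L[ℝ] EuclideanSpace ℝ (Fin n))) ∞
    (fun p => (⟨p, g p⟩ :
      Bundle.TotalSpace (EuclideanSpace ℝ (Fin n) →L[ℝ] EuclideanSpace ℝ (Fin n))
        (fun q : M => TangentSpace (𝓡 n) q →L[ℝ] TangentSpace (𝓡 n) q)))

/-- The exterior derivative: `(dα)_p` is the pull-back by the preferred chart at `p` of the exterior
derivative of the representation of `α` in this chart. -/
def extd {k : ℕ} (α : Form n M k) : Form n M (k + 1) := fun p =>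
  (extDeriv (inChart α p) (extChartAt (𝓡 n) p p)).compContinuousLinearMap
    (mfderiv (𝓡 n) 𝓘(ℝ, EuclideanSpace ℝ (Fin n)) (extChartAt (𝓡 n) p) p : Vec n →L[ℝ] Vec n)

/-- A function as a `0`-form. -/
def zeroForm (f : M → ℝ) : Form n M 0 :=
  fun p => ContinuousAlternatingMap.constOfIsEmpty ℝ (Vec n) (Fin 0) (f p)

/-- The part of the exterior derivative that raises the horizontal degree by `r`, for the
splitting given by the field of projections `g`: it maps a form `α` of bidegree `(p, q)` to the
component of `dα` of bidegree `(p + r, q + 1 - r)`. -/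
def extdShift (g : M → Vec n →L[ℝ] Vec n) (r : ℕ) {k : ℕ} (α : Form n M k) : Form n M (k + 1) :=
  fun x => ∑ p ∈ Finset.range (k + 1), comp (g x) (p + r) (extd (fun y => comp (g y) p (α y)) x)

/-- `d_{0,1}` -/
def d01 (g : M → Vec n →L[ℝ] Vec n) {k : ℕ} (α : Form n M k) : Form n M (k + 1) :=
  extdShift g 0 α

/-- `d_{1,0}` -/
def d10 (g : M → Vec n →L[ℝ] Vec n) {k : ℕ} (α : Form n M k) : Form n M (k + 1) :=
  extdShift g 1 α

/-- `d_{2,-1}` -/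
def d21 (g : M → Vec n →L[ℝ] Vec n) {k : ℕ} (α : Form n M k) : Form n M (k + 1) :=
  extdShift g 2 α

/-- The Lie derivative of a form of positive degree, by Cartan's formula. -/
def lieDeriv (X : Field n M) {k : ℕ} (α : Form n M (k + 1)) : Form n M (k + 1) := fun p =>
  extd (fun q => (α q).curryLeft (X q)) p + (extd α p).curryLeft (X p)

/-- The morphism `Π^♯ : a ↦ i_a Π` of a bivector field, applied to a `1`-form. -/
def sharp (P : MultiField n M 2) (α : Form n M 1) : Field n M :=
  fun p => toVec (intForm (l := 1) (α p) (P p))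

end Manifold

section Modular

variable {M : Type*} [TopologicalSpace M] [ChartedSpace (EuclideanSpace ℝ (Fin 5)) M]

/-- The divergence of `X` with respect to the volume form `Ω`: the factor in
`L_X Ω = (div X) Ω`, read off on the basis. -/
def divergence (Ω : Form 5 M 5) (X : Field 5 M) (p : M) : ℝ :=
  lieDeriv (k := 4) X Ω p basisVec / Ω p basisVec

/-- `Z` is the modular vector field of `P` relative to the volume form `Ω`:
`L_Z f = div_Ω (P^♯ df)` for all smooth functions `f`. -/
def IsModularVectorField [IsManifold (𝓡 5) ∞ M] (Ω : Form 5 M 5) (P : MultiField 5 M 2) (Z : Field 5 M) : Prop :=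
  SmoothField Z ∧ ∀ f : M → ℝ, ContMDiff (𝓡 5) 𝓘(ℝ, ℝ) ∞ f →
    ∀ p : M, (mfderiv (𝓡 5) 𝓘(ℝ, ℝ) f p : Vec 5 →L[ℝ] ℝ) (Z p) =
      divergence Ω (sharp P (extd (zeroForm f))) p

end Modular

/-! ### Fibered 5-manifolds over 2-dimensional bases -/

/-- A surjective submersion of a `5`-manifold with a volume form onto a surface with an area
form. -/
structure OrientedFibration (M B : Type*)
    [TopologicalSpace M] [ChartedSpace (EuclideanSpace ℝ (Fin 5)) M]
    [TopologicalSpace B] [ChartedSpace (EuclideanSpace ℝ (Fin 2)) B] where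
  proj : M → B
  proj_smooth : ContMDiff (𝓡 5) (𝓡 2) ∞ proj
  proj_surjective : Function.Surjective proj
  proj_submersion : ∀ p : M, Function.Surjective (mfderiv (𝓡 5) (𝓡 2) proj p)
  vol : Form 5 M 5
  vol_smooth : SmoothForm vol
  vol_ne_zero : ∀ p : M, vol p ≠ 0
  area : Form 2 B 2
  area_smooth : SmoothForm area
  area_ne_zero : ∀ b : B, area b ≠ 0

section Fibered

variable {M B : Type*}
  [TopologicalSpace M] [ChartedSpace (EuclideanSpace ℝ (Fin 5)) M]
  [TopologicalSpace B] [ChartedSpace (EuclideanSpace ℝ (Fin 2)) B]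

/-- The tangent map of the projection. -/
def OrientedFibration.dproj (F : OrientedFibration M B) (p : M) : Vec 5 →L[ℝ] Vec 2 :=
  mfderiv (𝓡 5) (𝓡 2) F.proj p

/-- `Ω^H = π^*ω` -/
def OrientedFibration.volH (F : OrientedFibration M B) : Form 5 M 2 := fun p =>
  (F.area (F.proj p)).compContinuousLinearMap (F.dproj p)

/-- The bivector field `ψ` on the base with `i_ψ ω = -1`. -/
def OrientedFibration.psi (F : OrientedFibration M B) : MultiField 2 B 2 := fun b =>
  Classical.epsilon fun Q : MultiVec 2 2 => intMulti (l := 0) Q (F.area b) ![] = -1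

/-- A triple of an Ehresmann connection, a smooth function and a vertical `1`-form (a `1`-form that
vanishes on the horizontal subbundle `ker γ`). -/
structure Setup [IsManifold (𝓡 5) ∞ M] (F : OrientedFibration M B) where
  conn : M → Vec 5 →L[ℝ] Vec 5
  conn_smooth : SmoothEndo conn
  conn_vertical : ∀ (p : M) (v : Vec 5), F.dproj p (conn p v) = 0
  conn_proj : ∀ (p : M) (v : Vec 5), F.dproj p v = 0 → conn p v = v
  kappa : M → ℝ
  kappa_smooth : ContMDiff (𝓡 5) 𝓘(ℝ, ℝ) ∞ kappa
  beta : Form 5 M 1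
  beta_smooth : SmoothForm beta
  beta_vertical : ∀ (p : M) (v : Vec 5), conn p v = 0 → beta p (fun _ => v) = 0

namespace Setup

variable [IsManifold (𝓡 5) ∞ M] {F : OrientedFibration M B} (T : Setup F)

/-- The horizontal lift of tangent vectors at `π(p)`: the linear right inverse of the tangent map
of the projection with values in `ker γ`. -/
def horLift (p : M) : Vec 2 →L[ℝ] Vec 5 :=
  Classical.epsilon fun L : Vec 2 →L[ℝ] Vec 5 =>
    (∀ u, F.dproj p (L u) = u) ∧ ∀ u, T.conn p (L u) = 0

/-- The horizontal lift of a multivector field on the base. -/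
def hor {k : ℕ} (Q : MultiField 2 B k) : MultiField 5 M k := fun p =>
  pushMulti (T.horLift p) (Q (F.proj p))

/-- `Ω^V`, the form of bidegree `(0,3)` with `Ω = Ω^H ∧ Ω^V`. -/
def volV : Form 5 M 3 := fun p =>
  Classical.epsilon fun a : Alt 5 3 => comp (T.conn p) 0 a = a ∧ F.vol p = wedge (F.volH p) a

/-- `Q_H`, the bivector field in `Γ ∧² ker γ` with `i_{Q_H} Ω^H = 1`. -/
def QH : MultiField 5 M 2 := fun p =>
  Classical.epsilon fun Q : MultiVec 5 2 =>
    pushMulti (ContinuousLinearMap.id ℝ (Vec 5) - T.conn p) Q = Q ∧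
      intMulti (l := 0) Q (F.volH p) ![] = 1

/-- `Q_V`, the vertical `3`-vector field with `i_{Q_V} Ω^V = 1`. -/
def QV : MultiField 5 M 3 := fun p =>
  Classical.epsilon fun Q : MultiVec 5 3 =>
    pushMulti (T.conn p) Q = Q ∧ intMulti (l := 0) Q (T.volV p) ![] = 1

/-- `P_β = -i_β Q_V` -/
def Pbeta : MultiField 5 M 2 := fun p => - intForm (l := 2) (T.beta p) (T.QV p)

/-- `Π = κ hor^γ ψ + P_β` -/
def tensor : MultiField 5 M 2 := fun p => T.kappa p • T.hor F.psi p + T.Pbeta p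

/-- `θ = -i_{Q_V} d_{1,0} Ω^V` -/
def theta : Form 5 M 1 := fun p => - intMulti (l := 1) (T.QV p) (d10 T.conn T.volV p)

/-- `ϱ = i_{Q_H} d_{2,-1} Ω^V` -/
def rho : Form 5 M 2 := fun p => intMulti (l := 2) (T.QH p) (d21 T.conn T.volV p)

/-- The integrability conditions: `d_{0,1}β ∧ β = 0`, `κ (d_{1,0}β - θ ∧ β) = 0` and
`d_{0,1}κ ∧ β - κ² ϱ = 0`. -/
def IsPoissonTriple : Prop :=
  ∀ p : M, wedge (d01 T.conn T.beta p) (T.beta p) = 0 ∧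
    T.kappa p • (d10 T.conn T.beta p - wedge (T.theta p) (T.beta p)) = 0 ∧
    wedge (d01 T.conn (zeroForm T.kappa) p) (T.beta p) - T.kappa p ^ 2 • T.rho p = 0

/-- `-i_{κθ + d_{1,0}κ} hor^γ ψ` -/
def Z10 : Field 5 M := fun p =>
  - toVec (intForm (l := 1) (T.kappa p • T.theta p + d10 T.conn (zeroForm T.kappa) p)
      (T.hor F.psi p))

/-- `i_{d_{0,1}β + κϱ} Q_V` -/
def Z01 : Field 5 M := fun p =>
  toVec (intForm (l := 1) (d01 T.conn T.beta p + T.kappa p • T.rho p) (T.QV p))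

end Setup

end Fibered

end AlmostCoupling

end

/-! Everything rests on the 3-form σ = -κ Ω^V - β ∧ Ω^H (`sigma`), which is Π contracted into Ω.
Testing on an adapted frame shows i_{Π^♯α} Ω = α ∧ σ for every 1-form α (`curryLeft_sharp_tensor`).
Take α = df. Since dΩ = 0 by degree, Cartan's formula gives L_{Π^♯df} Ω = d(df ∧ σ) = -df ∧ dσ.
Conversely df ∧ i_Z Ω = (Zf) Ω for any vector field Z, because df ∧ Ω = 0
(`covWedge_curryLeft_top`). So the field Z with i_Z Ω = -dσ satisfies Zf = div_Ω(Π^♯df)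
(`divergence_sharp_tensor`).

It remains to identify this field (`curryLeft_Z`). Write Ω^H = w dx ∧ dy with x, y, w pulled back
from a chart of B, so that σ = -κ Ω^V - dx ∧ dy ∧ wβ and dσ = -dκ ∧ Ω^V - κ dΩ^V - dx ∧ dy ∧ (dw ∧ β
+ w dβ). The dw term drops out because dw is killed by vertical vectors. Evaluated on a frame h₀, h₁
(horizontal), e₀, e₁, e₂ (vertical), the component of bidegree (1,3) is governed by κθ + d_{1,0}κ
and the one of bidegree (2,2) by d_{0,1}β + κϱ; these yield the horizontal and the vertical part of
Z.

Smoothness of Z follows from i_Z Ω = -dσ, since it presents the coordinates of Z in a chart as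
quotients of smooth functions (`smoothField_Z`). Uniqueness holds because differentials of smooth
functions exhaust each cotangent space (`exists_smooth_mfderiv_eq`).

The objects defined by choice (ψ, Q_H, Q_V, Ω^V, the horizontal lift) are made explicit on the
adapted frame by `epsilon_multiVec_eq`, `volV_spec` and `horLift_spec`. -/

noncomputable section

namespace AlmostCoupling

/-! ### Exterior multiplication by a covector -/

section CovWedge

variable {n k : ℕ}

/-- The wedge product of a covector and a form. -/
def covWedge (a : CoVec n) (α : Alt n k) : Alt n (k + 1) :=
  ContinuousAlternatingMap.alternatizeUncurryFin (a.smulRight α)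

theorem covWedge_apply (a : CoVec n) (α : Alt n k) (v : Fin (k + 1) → Vec n) :
    covWedge a α v = ∑ i : Fin (k + 1), (-1) ^ (i : ℕ) * (a (v i) * α (i.removeNth v)) := by
  simp [covWedge, ContinuousAlternatingMap.alternatizeUncurryFin_apply]

theorem covWedge_add (a : CoVec n) (α α' : Alt n k) :
    covWedge a (α + α') = covWedge a α + covWedge a α' := by
  ext v
  simp [covWedge_apply, mul_add, Finset.sum_add_distrib]

theorem covWedge_smul (a : CoVec n) (r : ℝ) (α : Alt n k) :
    covWedge a (r • α) = r • covWedge a α := by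
  ext v
  simp only [covWedge_apply, ContinuousAlternatingMap.smul_apply, smul_eq_mul, Finset.mul_sum]
  exact Finset.sum_congr rfl fun i _ => by ring

theorem covWedge_neg (a : CoVec n) (α : Alt n k) : covWedge a (-α) = -covWedge a α := by
  ext v
  simp [covWedge_apply]

theorem covWedge_sub (a : CoVec n) (α α' : Alt n k) :
    covWedge a (α - α') = covWedge a α - covWedge a α' := by
  rw [sub_eq_add_neg, covWedge_add, covWedge_neg, ← sub_eq_add_neg]

theorem add_covWedge (a b : CoVec n) (α : Alt n k) :
    covWedge (a + b) α = covWedge a α + covWedge b α := by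
  ext v
  simp [covWedge_apply, mul_add, add_mul, Finset.sum_add_distrib]

/-- The tensor a ⊗ a ⊗ α is symmetric in its first two slots, so alternating it twice gives zero, as
in the proof of d² = 0. -/
theorem covWedge_covWedge_self (a : CoVec n) (α : Alt n k) : covWedge a (covWedge a α) = 0 := by
  have h := ContinuousAlternatingMap.alternatizeUncurryFin_alternatizeUncurryFinCLM_comp_of_symmetric
    (f := a.smulRight (a.smulRight α)) (fun x y => by simp [smul_smul, mul_comm])
  refine Eq.trans (congrArg ContinuousAlternatingMap.alternatizeUncurryFin ?_) h
  ext1 x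
  simp [covWedge]

theorem covWedge_covWedge_comm (a b : CoVec n) (α : Alt n k) :
    covWedge a (covWedge b α) = -covWedge b (covWedge a α) := by
  have h := covWedge_covWedge_self (a + b) α
  rw [add_covWedge, add_covWedge, covWedge_add, covWedge_add, covWedge_covWedge_self,
    covWedge_covWedge_self, zero_add, add_zero] at h
  exact eq_neg_of_add_eq_zero_left h

theorem covWedge_compContinuousLinearMap {m : ℕ} (a : CoVec n) (α : Alt n k)
    (L : Vec m →L[ℝ] Vec n) :
    (covWedge a α).compContinuousLinearMap L =
      covWedge (a.comp L) (α.compContinuousLinearMap L) := by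
  ext v
  simp only [covWedge_apply, ContinuousAlternatingMap.compContinuousLinearMap_apply]
  rfl

/-- The antiderivation rule i_x(a ∧ α) = a(x) α - a ∧ i_x α: the first summand is the term i = 0,
and the other terms carry one extra sign. -/
theorem covWedge_cons (a : CoVec n) (α : Alt n (k + 1)) (x : Vec n) (v : Fin (k + 1) → Vec n) :
    covWedge a α (Matrix.vecCons x v) = a x * α v - covWedge a (α.curryLeft x) v := by
  rw [covWedge_apply, Fin.sum_univ_succ, covWedge_apply, sub_eq_add_neg, ← Finset.sum_neg_distrib]
  congr 1
  · simp
  · refine Finset.sum_congr rfl fun i _ => ?_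
    have : (i.succ).removeNth (Matrix.vecCons x v) = Matrix.vecCons x (i.removeNth v) := by
      ext j : 1
      refine Fin.cases ?_ (fun j => ?_) j <;> simp [Fin.removeNth, Matrix.vecCons]
    rw [this]
    simp [pow_succ]

/-- A form of degree `n + 1` in dimension `n + 1` that vanishes on a basis is zero. -/
theorem eq_zero_of_basis {m : ℕ} (b : Module.Basis (Fin m) ℝ (Vec n)) (τ : Alt n m)
    (h : τ b = 0) : τ = 0 := by
  have := AlternatingMap.eq_smul_basis_det b τ.toAlternatingMap
  ext v
  have h2 := congrArg (fun f => f v) this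
  simpa [h] using h2

/-- A form of codegree one that is annihilated by all covectors is zero. -/
theorem eq_zero_of_covWedge {m : ℕ} (b : Module.Basis (Fin (m + 1)) ℝ (Vec n)) (τ : Alt n m)
    (h : ∀ c : CoVec n, covWedge c τ b = 0) : τ = 0 := by
  apply ContinuousAlternatingMap.toAlternatingMap_injective
  refine Module.Basis.ext_alternating b fun J hJ => ?_
  -- A tuple of m indices misses some j among m + 1. Wedging with the j-th dual covector and
  -- inserting b j first leaves τ on the tuple as the only term.
  obtain ⟨j, hj⟩ : ∃ j, ∀ i, J i ≠ j := by
    by_contra! hcon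
    have := Fintype.card_le_of_surjective J hcon
    simp at this
  have h1 := eq_zero_of_basis b _ (h (LinearMap.toContinuousLinearMap (b.coord j)))
  have h2 := congrArg (fun f => f (Matrix.vecCons (b j) fun i => b (J i))) h1
  simp only [covWedge_apply, ContinuousAlternatingMap.coe_zero, Pi.zero_apply] at h2
  rw [Fin.sum_univ_succ] at h2
  simpa [Finsupp.single_apply, hj] using h2

end CovWedge

/-! ### Decomposable multivectors and interior products -/

section Multivectors

variable {n k l : ℕ}

theorem sum_smul_basisVec (x : Vec n) : ∑ i, x i • basisVec i = x := by
  have := (EuclideanSpace.basisFun (Fin n) ℝ).sum_repr x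
  simpa [basisVec] using this

@[simp]
theorem basisCoVec_apply (i : Fin n) (x : Vec n) : basisCoVec i x = x i := rfl

theorem covector_apply (c : CoVec n) (x : Vec n) : c x = ∑ i, x i * c (basisVec i) := by
  conv_lhs => rw [← sum_smul_basisVec x]
  simp

theorem covector_eq_sum (c : CoVec n) : c = ∑ i, c (basisVec i) • basisCoVec i := by
  ext x
  rw [covector_apply c x]
  simp [sum_apply, mul_comm]

theorem map_eq_sum_basisVec (f : MultilinearMap ℝ (fun _ : Fin k => Vec n) ℝ) (x : Fin k → Vec n) :
    f x = ∑ J : Fin k → Fin n, (∏ i, x i (J i)) * f fun i => basisVec (J i) := by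
  conv_lhs => rw [show x = fun i => ∑ j, x i j • basisVec j from
    funext fun i => (sum_smul_basisVec (x i)).symm]
  rw [f.map_sum]
  exact Finset.sum_congr rfl fun J _ => f.map_smul_univ _ _

/-- The decomposable `k`-vector `x₁ ∧ … ∧ x_k`. -/
def decomp (x : Fin k → Vec n) : MultiVec n k :=
  { Matrix.detRowAlternating.compLinearMap
      (LinearMap.pi fun j => (ContinuousLinearMap.apply ℝ ℝ (x j) : CoVec n →ₗ[ℝ] ℝ)) with
    cont := by
      change Continuous fun a : Fin k → CoVec n => Matrix.det (Matrix.of fun i j => a i (x j))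
      refine Continuous.matrix_det ?_
      refine continuous_pi fun i => continuous_pi fun j => ?_
      exact (ContinuousLinearMap.apply ℝ ℝ (x j)).continuous.comp (continuous_apply i) }

theorem decomp_apply (x : Fin k → Vec n) (a : Fin k → CoVec n) :
    decomp x a = Matrix.det (Matrix.of fun i j => a i (x j)) := rfl

/-- In the Leibniz expansion each of the k! permutations contributes f x: reindexing J by σ produces
the sign of σ a second time. This is what the factor 1/k! in `intMulti` compensates. -/
theorem sum_decomp_mul (x : Fin k → Vec n) (f : Vec n [⋀^Fin k]→ₗ[ℝ] ℝ) :
    ∑ J : Fin k → Fin n, decomp x (fun i => basisCoVec (J i)) * f (fun i => basisVec (J i)) =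
      k.factorial * f x := by
  simp only [decomp_apply, Matrix.det_apply, Finset.sum_mul]
  rw [Finset.sum_comm]
  have h : ∀ σ : Equiv.Perm (Fin k), ∑ J : Fin k → Fin n,
      (Equiv.Perm.sign σ • ∏ i, (Matrix.of fun i j => basisCoVec (J i) (x j)) (σ i) i) *
        f (fun i => basisVec (J i)) = f x := by
    intro σ
    rw [← AlternatingMap.coe_multilinearMap, map_eq_sum_basisVec _ x]
    refine Fintype.sum_equiv (Equiv.arrowCongr σ.symm (Equiv.refl (Fin n))) _ _ fun J => ?_
    have h2 := f.map_perm (fun i => basisVec (J i)) σ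
    simp only [AlternatingMap.coe_multilinearMap, Matrix.of_apply, basisCoVec_apply]
    change _ = (∏ i, x i (J (σ i))) * f ((fun i => basisVec (J i)) ∘ σ)
    rw [h2]
    rcases Int.units_eq_one_or (Equiv.Perm.sign σ) with h4 | h4 <;> rw [h4] <;> simp
  rw [Finset.sum_congr rfl fun σ _ => h σ]
  simp [Fintype.card_perm]

/-! ### Iterated interior products as evaluations -/

section Iter

variable {V : Type*}

/-- The tuple `(X_{k-1}, …, X_0, v_0, …, v_{l-1})`. -/
def revAppend (X : Fin k → V) (v : Fin l → V) : Fin (l + k) → V := fun i =>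
  if h : (i : ℕ) < k then X (Fin.rev ⟨i, h⟩) else v ⟨i - k, by omega⟩

theorem revAppend_update (X : Fin k → V) (v : Fin l → V) (i : Fin k) (x : V) :
    revAppend (Function.update X i x) v =
      Function.update (revAppend X v) ⟨i.rev, by omega⟩ x := by
  funext j
  by_cases hj : (j : ℕ) < k
  · by_cases hij : Fin.rev ⟨j, hj⟩ = i
    · subst hij
      simp [revAppend, hj]
    · rw [Function.update_of_ne]
      · simp [revAppend, hj, Function.update_of_ne hij]
      · rintro rfl
        exact hij (Fin.rev_rev i)
  · rw [Function.update_of_ne]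
    · simp [revAppend, hj]
    · rintro rfl
      exact hj (Fin.rev i).2

theorem revAppend_rev (X : Fin k → V) (v : Fin l → V) (i : Fin k) :
    revAppend X v ⟨i.rev, by omega⟩ = X i := by
  have h : revAppend X v ⟨i.rev, by omega⟩ = X (Fin.rev i.rev) := dif_pos i.rev.2
  rw [h, Fin.rev_rev]

variable [NormedAddCommGroup V] [NormedSpace ℝ V]

/-- The last vector is inserted first and so occupies slot 0; hence the reversed order, the source
of the signs in the contractions below. -/
theorem iterInt_apply : ∀ (k : ℕ) (X : Fin k → V) (a : V [⋀^Fin (l + k)]→L[ℝ] ℝ) (v : Fin l → V),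
    iterInt k X a v = a (revAppend X v)
  | 0, X, a, v => by
    change a v = _
    congr 1
  | k + 1, X, a, v => by
    rw [iterInt, iterInt_apply k]
    change a (Matrix.vecCons (X (Fin.last k)) _) = _
    congr 1
    funext i
    refine Fin.cases ?_ (fun i => ?_) i
    · simp [revAppend, Fin.rev, Fin.last]
    · simp only [Matrix.cons_val_succ, revAppend, Fin.val_succ, Nat.add_lt_add_iff_right,
        Nat.add_sub_add_right]
      split_ifs
      · congr 1
        ext
        simp [Fin.rev]
      · rfl

/-- The iterated interior product as an alternating map of the inserted vectors. -/
def iterIntAlternating (a : V [⋀^Fin (l + k)]→L[ℝ] ℝ) (v : Fin l → V) : V [⋀^Fin k]→ₗ[ℝ] ℝ where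
  toFun X := iterInt k X a v
  map_update_add' {inst} X i x y := by
    obtain rfl : inst = instDecidableEqFin k := Subsingleton.elim _ _
    simp only [iterInt_apply, revAppend_update]
    exact a.map_update_add _ _ _ _
  map_update_smul' {inst} X i r x := by
    obtain rfl : inst = instDecidableEqFin k := Subsingleton.elim _ _
    simp only [iterInt_apply, revAppend_update]
    exact a.map_update_smul _ _ _ _
  map_eq_zero_of_eq' X i j h hij := by
    rw [iterInt_apply]
    refine a.map_eq_zero_of_eq _ (i := ⟨i.rev, by omega⟩) (j := ⟨j.rev, by omega⟩) ?_ ?_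
    · rw [revAppend_rev, revAppend_rev, h]
    · simpa [Fin.ext_iff] using fun h => hij (Fin.rev_injective (Fin.ext h))

end Iter

theorem intMulti_apply (Q : MultiVec n k) (a : Alt n (l + k)) (v : Fin l → Vec n) :
    intMulti Q a v = (k.factorial : ℝ)⁻¹ * ∑ J : Fin k → Fin n,
      Q (fun i => basisCoVec (J i)) * iterInt k (fun i => basisVec (J i)) a v := by
  simp [intMulti, ContinuousAlternatingMap.sum_apply]

theorem intForm_apply (a : Alt n k) (Q : MultiVec n (l + k)) (c : Fin l → CoVec n) :
    intForm a Q c = (k.factorial : ℝ)⁻¹ * ∑ J : Fin k → Fin n,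
      a (fun i => basisVec (J i)) * iterInt k (fun i => basisCoVec (J i)) Q c := by
  simp [intForm, ContinuousAlternatingMap.sum_apply]

/-- Reduces a contraction with a decomposable multivector to one evaluation of the form. It applies
to Q_H and Q_V, which are multiples of frame wedges. -/
theorem intMulti_smul_decomp (t : ℝ) (x : Fin k → Vec n) (a : Alt n (l + k)) (v : Fin l → Vec n) :
    intMulti (t • decomp x) a v = t * iterInt k x a v := by
  have h := sum_decomp_mul x (iterIntAlternating a v)
  change ∑ J : Fin k → Fin n, decomp x (fun i => basisCoVec (J i)) *
    iterInt k (fun i => basisVec (J i)) a v = k.factorial * iterInt k x a v at h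
  rw [intMulti_apply]
  simp only [ContinuousAlternatingMap.smul_apply, smul_eq_mul, mul_assoc, ← Finset.mul_sum]
  rw [h]
  have : (k.factorial : ℝ) ≠ 0 := by positivity
  field_simp

/-- The covector of a `1`-form. -/
def toCov (a : Alt n 1) : CoVec n := (ContinuousAlternatingMap.ofSubsingleton ℝ (Vec n) ℝ 0).symm a

theorem toCov_apply (a : Alt n 1) (x : Vec n) : toCov a x = a fun _ => x := rfl

theorem apply_eq_toCov (a : Alt n 1) (v : Fin 1 → Vec n) : a v = toCov a (v 0) := by
  rw [toCov_apply]
  congr 1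
  funext i
  rw [Subsingleton.elim i 0]

theorem intForm_one_apply (a : Alt n 1) (Q : MultiVec n (l + 1)) (c : Fin l → CoVec n) :
    intForm a Q c = Q (Matrix.vecCons (toCov a) c) := by
  rw [intForm_apply, Fintype.sum_equiv (Equiv.funUnique (Fin 1) (Fin n)) _
    (fun j => toCov a (basisVec j) * Q.curryLeft (basisCoVec j) c) fun J => by
      simp [apply_eq_toCov, iterInt]]
  have h : Q (Matrix.vecCons (toCov a) c) = Q.curryLeft (toCov a) c := rfl
  rw [h]
  conv_rhs => rw [covector_eq_sum (toCov a)]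
  simp [ContinuousAlternatingMap.sum_apply]

theorem apply_toVec (c : CoVec n) (Q : MultiVec n 1) : c (toVec Q) = Q fun _ => c := by
  have h : ∀ c : CoVec n, (Q fun _ => c) =
      (ContinuousAlternatingMap.ofSubsingleton ℝ (CoVec n) ℝ 0).symm Q c := fun c => rfl
  rw [h]
  conv_rhs => rw [covector_eq_sum c]
  rw [toVec, map_sum, map_sum]
  refine Finset.sum_congr rfl fun i _ => ?_
  rw [map_smul, map_smul, smul_eq_mul, smul_eq_mul, mul_comm, h]

theorem apply_toVec_intForm_one (c : CoVec n) (a : Alt n 1) (P : MultiVec n 2) :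
    c (toVec (intForm (l := 1) a P)) = P ![toCov a, c] := by
  rw [apply_toVec, intForm_one_apply]
  congr 1
  funext i
  fin_cases i <;> rfl

/-- Expand the determinant along the row of c: each 2×2 minor pairs with `a` twice, cancelling 1/2!.
The minus sign comes from i_{a₁ ∧ a₂} = i_{a₁} ∘ i_{a₂} putting a₂ in the first slot. -/
theorem apply_toVec_intForm_two (c : CoVec n) (a : Alt n 2) (t : ℝ) (e : Fin 3 → Vec n) :
    c (toVec (intForm (l := 1) a (t • decomp e : MultiVec n 3))) =
      -t * (a ![e 1, e 2] * c (e 0) + a ![e 2, e 0] * c (e 1) + a ![e 0, e 1] * c (e 2)) := by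
  have hs : ∀ x y : Vec n, ∑ J : Fin 2 → Fin n, a (fun i => basisVec (J i)) * (x (J 0) * y (J 1)) =
      a ![x, y] := by
    intro x y
    have := map_eq_sum_basisVec (a.toAlternatingMap : MultilinearMap ℝ (fun _ : Fin 2 => Vec n) ℝ) ![x, y]
    refine Eq.trans (Finset.sum_congr rfl fun J _ => ?_) this.symm
    rw [mul_comm]
    simp [Fin.prod_univ_two]
  have hsw : ∀ x y : Vec n, a ![y, x] = - a ![x, y] := by
    intro x y
    have := a.map_swap ![x, y] (i := 0) (j := 1) (by decide)
    refine Eq.trans ?_ this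
    change a _ = a _
    congr 1
    funext i
    fin_cases i <;> rfl
  have hQ : ∀ J : Fin 2 → Fin n, iterInt 2 (fun i => basisCoVec (J i))
      (t • decomp e : MultiVec n 3) (fun _ : Fin 1 => c) =
      t * Matrix.det !![e 0 (J 1), e 1 (J 1), e 2 (J 1); e 0 (J 0), e 1 (J 0), e 2 (J 0);
        c (e 0), c (e 1), c (e 2)] := by
    intro J
    rw [iterInt_apply]
    simp only [ContinuousAlternatingMap.smul_apply, smul_eq_mul, decomp_apply]
    congr 2
    ext i j
    fin_cases i <;> fin_cases j <;> rfl
  rw [apply_toVec, intForm_apply]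
  simp only [hQ, Matrix.det_fin_three]
  simp only [Matrix.of_apply, Matrix.cons_val', Matrix.cons_val_zero, Matrix.cons_val_one,
    Matrix.cons_val]
  rw [show (2 : ℕ).factorial = 2 from rfl]
  have h3 : ∀ J : Fin 2 → Fin n, a (fun i => basisVec (J i)) *
      (t * (e 0 (J 1) * e 1 (J 0) * c (e 2) - e 0 (J 1) * e 2 (J 0) * c (e 1) -
        e 1 (J 1) * e 0 (J 0) * c (e 2) + e 1 (J 1) * e 2 (J 0) * c (e 0) +
        e 2 (J 1) * e 0 (J 0) * c (e 1) - e 2 (J 1) * e 1 (J 0) * c (e 0))) =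
      t * c (e 2) * (a (fun i => basisVec (J i)) * (e 1 (J 0) * e 0 (J 1))) -
      t * c (e 1) * (a (fun i => basisVec (J i)) * (e 2 (J 0) * e 0 (J 1))) -
      t * c (e 2) * (a (fun i => basisVec (J i)) * (e 0 (J 0) * e 1 (J 1))) +
      t * c (e 0) * (a (fun i => basisVec (J i)) * (e 2 (J 0) * e 1 (J 1))) +
      t * c (e 1) * (a (fun i => basisVec (J i)) * (e 0 (J 0) * e 2 (J 1))) -
      t * c (e 0) * (a (fun i => basisVec (J i)) * (e 1 (J 0) * e 2 (J 1))) := fun J => by ring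
  simp only [h3, Finset.sum_add_distrib, Finset.sum_sub_distrib, ← Finset.mul_sum, hs]
  rw [hsw (e 0) (e 1), hsw (e 1) (e 2), hsw (e 0) (e 2)]
  push_cast
  ring

/-- A multivector supported on the image of `E` is a multiple of the decomposable one. -/
theorem eq_smul_decomp (E : Vec k →L[ℝ] Vec n) (P : Vec n →L[ℝ] Vec k) (Q : MultiVec n k)
    (hQ : pushMulti (E.comp P) Q = Q) :
    Q = (Q fun i => (basisCoVec i).comp P) • decomp fun i => E (basisVec i) := by
  -- `S` pulls covectors of ℝ^k back along `P`. Then Q ∘ S is alternating of top degree on ℝ^k,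
  -- hence a multiple of the determinant, and invariance under E ∘ P recovers Q from it.
  let S : (Fin k → ℝ) →ₗ[ℝ] CoVec n :=
    ∑ j, (LinearMap.proj j).smulRight ((basisCoVec j).comp P)
  have hS : ∀ c : CoVec n, S (fun j => c (E (basisVec j))) = c.comp (E.comp P) := by
    intro c
    ext x
    simp only [S, LinearMap.sum_apply, LinearMap.smulRight_apply, LinearMap.proj_apply]
    change (∑ j, c (E (basisVec j)) • (basisCoVec j).comp P) x = (c.comp E) (P x)
    rw [covector_apply (c.comp E)]
    simp [sum_apply, mul_comm]
  have h := AlternatingMap.eq_smul_basis_det (Pi.basisFun ℝ (Fin k)) (Q.toAlternatingMap.compLinearMap S)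
  ext a
  have h2 := congrArg (fun f => f fun i j => a i (E (basisVec j))) h
  rw [← hQ]
  have h3 : ∀ i, S ((Pi.basisFun ℝ (Fin k)) i) = (basisCoVec i).comp P := by
    intro i
    ext x
    simp [S, LinearMap.sum_apply, Pi.single_apply]
  simp only [AlternatingMap.compLinearMap_apply, hS, h3, AlternatingMap.smul_apply, Pi.basisFun_det] at h2
  refine Eq.trans h2 ?_
  rw [hQ]
  rfl

theorem pushMulti_smul_decomp {m : ℕ} (L : Vec m →L[ℝ] Vec n) (t : ℝ) (x : Fin k → Vec m) :
    pushMulti L (t • decomp x) = t • decomp fun i => L (x i) := rfl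

end Multivectors

/-! ### Wedge products and bigraded components on adapted tuples -/

section Adapted

variable {n k l : ℕ}

/-- Only the identity shuffle survives: any other one feeds a vector of the second block to `a`. -/
theorem wedge_apply_of_vanish (a : Alt n k) (b : Alt n l) (v : Fin (k + l) → Vec n)
    (h : ∀ w : Fin k → Vec n, (∃ i j, w i = v (Fin.natAdd k j)) → a w = 0) :
    wedge a b v = a (fun i => v (Fin.castAdd l i)) * b (fun j => v (Fin.natAdd k j)) := by
  change LinearMap.mul' ℝ ℝ ((a.toAlternatingMap.domCoprod b.toAlternatingMap)
    fun i => v (finSumFinEquiv i)) = _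
  have hsum : (a.toAlternatingMap.domCoprod b.toAlternatingMap) (fun i => v (finSumFinEquiv i)) =
      AlternatingMap.domCoprod.summand a.toAlternatingMap b.toAlternatingMap
        (Quotient.mk'' 1) (fun i => v (finSumFinEquiv i)) := by
    rw [AlternatingMap.domCoprod_apply, sum_apply]
    refine Finset.sum_eq_single _ (fun σ _ hσ => ?_) (fun h => absurd (Finset.mem_univ _) h)
    induction σ using Quotient.inductionOn' with
    | _ σ =>
      rw [AlternatingMap.domCoprod.summand_mk'']
      -- A permutation preserving the first block is a product of block permutations, so its coset
      -- is the trivial one.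
      by_cases hm : ∀ i : Fin k, ∃ i' : Fin k, σ (Sum.inl i) = Sum.inl i'
      · exfalso
        apply hσ
        have hr := Equiv.Perm.mem_sumCongrHom_range_of_perm_mapsTo_inl (σ := σ) (by
          rintro _ ⟨i, rfl⟩
          obtain ⟨i', hi'⟩ := hm i
          exact ⟨i', hi'.symm⟩)
        refine Quotient.sound' ?_
        rw [QuotientGroup.leftRel_apply]
        simpa using hr
      · push Not at hm
        obtain ⟨i, hi⟩ := hm
        have h0 : a (fun i => v (finSumFinEquiv (σ (Sum.inl i)))) = 0 := by
          rcases hj : σ (Sum.inl i) with i' | j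
          · exact absurd hj (hi i')
          · refine h _ ⟨i, j, ?_⟩
            rw [hj]
            rfl
        have h1 : ((MultilinearMap.domCoprod
            (a.toAlternatingMap : MultilinearMap ℝ (fun _ : Fin k => Vec n) ℝ)
            (b.toAlternatingMap : MultilinearMap ℝ (fun _ : Fin l => Vec n) ℝ)).domDomCongr σ)
            (fun i => v (finSumFinEquiv i)) = 0 := by
          change a (fun i => v (finSumFinEquiv (σ (Sum.inl i)))) ⊗ₜ[ℝ] _ = _
          rw [h0, TensorProduct.zero_tmul]
        rcases Int.units_eq_one_or (Equiv.Perm.sign σ) with h4 | h4 <;> rw [h4] <;> simp [h1]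
  rw [hsum, AlternatingMap.domCoprod.summand_mk'']
  simp

theorem comp_apply (g : Vec n →L[ℝ] Vec n) (p : ℕ) (a : Alt n k) (v : Fin k → Vec n) :
    comp g p a v = ∑ S ∈ Finset.powersetCard p (Finset.univ : Finset (Fin k)),
      a (fun i => if i ∈ S then v i - g (v i) else g (v i)) := by
  change (∑ S ∈ Finset.powersetCard p (Finset.univ : Finset (Fin k)), partComp g S a) v = _
  rw [sum_apply]
  refine Finset.sum_congr rfl fun S _ => ?_
  change a _ = _
  congr 1
  funext i
  by_cases h : i ∈ S <;> simp [h]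

theorem comp_zero_apply (g : Vec n →L[ℝ] Vec n) (a : Alt n k) (v : Fin k → Vec n) :
    comp g 0 a v = a fun i => g (v i) := by
  rw [comp_apply]
  simp

/-- On a tuple of horizontal and vertical vectors, the component of the matching bidegree is the
form itself. -/
theorem comp_apply_adapted (g : Vec n →L[ℝ] Vec n) (a : Alt n k) (v : Fin k → Vec n)
    (H : Finset (Fin k)) (hH : ∀ i ∈ H, g (v i) = 0) (hV : ∀ i ∉ H, g (v i) = v i) :
    comp g H.card a v = a v := by
  rw [comp_apply, Finset.sum_eq_single H]
  · congr 1
    funext i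
    split_ifs with h
    · rw [hH i h, sub_zero]
    · exact hV i h
  · intro S hS hne
    rw [Finset.mem_powersetCard] at hS
    -- A different set of the same size contains a vertical slot, where 1 - g gives zero.
    obtain ⟨i, hiS, hiH⟩ : ∃ i ∈ S, i ∉ H := by
      by_contra! hcon
      exact hne (Finset.eq_of_subset_of_card_le hcon hS.2.ge)
    refine a.map_coord_zero i ?_
    rw [if_pos hiS, hV i hiH, sub_self]
  · intro h
    exact absurd (Finset.mem_powersetCard.2 ⟨Finset.subset_univ _, rfl⟩) h

/-- A nonempty `S` puts g(1 - g) = 0 into some slot, so the form is purely of bidegree (0, k). -/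
theorem comp_of_vertical (g : Vec n →L[ℝ] Vec n) (hg : ∀ x, g (g x) = g x) (a : Alt n k)
    (ha : ∀ v, a (fun i => g (v i)) = a v) (p : ℕ) :
    comp g p a = if p = 0 then a else 0 := by
  ext v
  split_ifs with hp
  · rw [hp, comp_zero_apply, ha]
  · rw [comp_apply]
    refine Finset.sum_eq_zero fun S hS => ?_
    rw [Finset.mem_powersetCard] at hS
    obtain ⟨i, hi⟩ : S.Nonempty := Finset.card_pos.1 (by omega)
    rw [← ha]
    refine a.map_coord_zero i ?_
    simp [hi, hg]

end Adapted

section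

/-! ### The pointwise data of a triple -/

/-- Reversing two vectors is odd, and so is reversing three (next lemma). Hence i_ψ ω = -1 gives ψ a
positive coefficient over w, while Q_H and Q_V get negative ones. -/
theorem iterInt_two_self {n : ℕ} (e : Fin 2 → Vec n) (a : Alt n 2) :
    iterInt (l := 0) 2 e a ![] = -a e := by
  have h := a.map_swap e (i := 0) (j := 1) (by decide)
  rw [iterInt_apply]
  refine Eq.trans ?_ h
  change a _ = a _
  congr 1
  funext i
  fin_cases i <;> rfl

theorem iterInt_three_self {n : ℕ} (e : Fin 3 → Vec n) (a : Alt n 3) :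
    iterInt (l := 0) 3 e a ![] = -a e := by
  have h := a.map_swap e (i := 0) (j := 2) (by decide)
  rw [iterInt_apply]
  refine Eq.trans ?_ h
  change a _ = a _
  congr 1
  funext i
  fin_cases i <;> rfl

/-- The k-vectors fixed by E ∘ P form a line, and the normalisation singles out one point of it, so
the chosen object is forced. Serves ψ, Q_H and Q_V alike. -/
theorem epsilon_multiVec_eq {n k : ℕ} (E : Vec k →L[ℝ] Vec n) (P : Vec n →L[ℝ] Vec k)
    (hPE : ∀ x, P (E x) = x) (a : Alt n (0 + k)) (r s : ℝ) (hs : s ≠ 0)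
    (ha : iterInt k (fun i => E (basisVec i)) a ![] = s) :
    Classical.epsilon (fun Q : MultiVec n k =>
      pushMulti (E.comp P) Q = Q ∧ intMulti (l := 0) Q a ![] = r) =
        (r / s) • decomp fun i => E (basisVec i) := by
  have hex : ∃ Q : MultiVec n k, pushMulti (E.comp P) Q = Q ∧ intMulti (l := 0) Q a ![] = r := by
    refine ⟨(r / s) • decomp fun i => E (basisVec i), ?_, ?_⟩
    · rw [pushMulti_smul_decomp]
      simp [hPE]
    · rw [intMulti_smul_decomp, ha, div_mul_cancel₀ _ hs]
  have h := Classical.epsilon_spec hex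
  generalize Classical.epsilon (fun Q : MultiVec n k =>
    pushMulti (E.comp P) Q = Q ∧ intMulti (l := 0) Q a ![] = r) = Q at h
  obtain ⟨h1, h2⟩ := h
  have h3 := eq_smul_decomp E P Q h1
  rw [h3, intMulti_smul_decomp, ha] at h2
  rw [h3, ← h2, mul_div_cancel_right₀ _ hs]

section Manifold

variable {n : ℕ} {M : Type*} [TopologicalSpace M] [ChartedSpace (EuclideanSpace ℝ (Fin n)) M]

theorem extd_zero {k : ℕ} (x : M) : extd (fun _ : M => (0 : Alt n k)) x = 0 := by
  have h : inChart (fun _ : M => (0 : Alt n k)) x = fun _ => 0 := rfl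
  have h2 : extDeriv (fun _ : Vec n => (0 : Alt n k)) (extChartAt (𝓡 n) x x) = 0 := by
    simp [extDeriv, ← ContinuousAlternatingMap.alternatizeUncurryFinCLM_apply]
  rw [extd, h, h2]
  rfl

/-- Only the component of horizontal degree 0 is nonzero, so the sum defining the shifted derivative
has one term. Applies to Ω^V, β and κ. -/
theorem extdShift_of_vertical (g : M → Vec n →L[ℝ] Vec n) (hg : ∀ y x, g y (g y x) = g y x)
    {k : ℕ} (α : Form n M k) (hα : ∀ y v, α y (fun i => g y (v i)) = α y v) (r : ℕ) (x : M) :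
    extdShift g r α x = comp (g x) r (extd α x) := by
  have h : ∀ p, (fun y => comp (g y) p (α y)) = if p = 0 then α else fun _ => 0 := by
    intro p
    funext y
    rw [comp_of_vertical (g y) (hg y) (α y) (hα y)]
    split_ifs <;> rfl
  rw [extdShift, Finset.sum_eq_single 0]
  · rw [h, if_pos rfl, zero_add]
  · intro p _ hp
    rw [h, if_neg hp, extd_zero]
    ext v
    rw [comp_apply]
    simp
  · simp

end Manifold

variable {M B : Type*}
  [TopologicalSpace M] [ChartedSpace (EuclideanSpace ℝ (Fin 5)) M]
  [TopologicalSpace B] [ChartedSpace (EuclideanSpace ℝ (Fin 2)) B]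

/-- The value of the area form on the standard basis at `π(p)`. -/
def OrientedFibration.areaCoeff (F : OrientedFibration M B) (b : B) : ℝ := F.area b basisVec

theorem OrientedFibration.areaCoeff_ne_zero (F : OrientedFibration M B) (b : B) :
    F.areaCoeff b ≠ 0 := by
  intro h
  refine F.area_ne_zero b (eq_zero_of_basis (EuclideanSpace.basisFun (Fin 2) ℝ).toBasis _ ?_)
  rw [← h]
  unfold OrientedFibration.areaCoeff
  congr 1
  funext i
  simp [basisVec]

theorem OrientedFibration.psi_eq (F : OrientedFibration M B) (b : B) :
    F.psi b = (F.areaCoeff b)⁻¹ • decomp basisVec := by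
  have h := epsilon_multiVec_eq (ContinuousLinearMap.id ℝ (Vec 2)) (ContinuousLinearMap.id ℝ (Vec 2))
    (fun _ => rfl) (F.area b) (-1) (-F.areaCoeff b) (neg_ne_zero.2 (F.areaCoeff_ne_zero b))
    (iterInt_two_self _ _)
  rw [neg_div_neg_eq, one_div] at h
  rw [OrientedFibration.psi]
  refine Eq.trans ?_ h
  congr 1
  funext Q
  exact propext ⟨fun h => ⟨rfl, h⟩, fun h => h.2⟩

theorem OrientedFibration.volH_apply (F : OrientedFibration M B) (p : M) (v : Fin 2 → Vec 5) :
    F.volH p v = F.area (F.proj p) fun i => F.dproj p (v i) := rfl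

theorem OrientedFibration.volH_eq_zero (F : OrientedFibration M B) (p : M) (v : Fin 2 → Vec 5) (i : Fin 2) (hi : F.dproj p (v i) = 0) :
    F.volH p v = 0 := by
  rw [F.volH_apply]
  exact (F.area (F.proj p)).map_coord_zero i hi

/-- Ω^H vanishes as soon as one argument is vertical, so the shuffle sum collapses. -/
theorem OrientedFibration.wedge_volH (F : OrientedFibration M B) (p : M) (a : Alt 5 3) (x : Fin 2 → Vec 5) (z : Fin 3 → Vec 5)
    (hz : ∀ i, F.dproj p (z i) = 0) :
    wedge (F.volH p) a ![x 0, x 1, z 0, z 1, z 2] = F.volH p x * a z := by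
  rw [wedge_apply_of_vanish]
  · congr 2
    · funext i
      fin_cases i <;> rfl
    · funext i
      fin_cases i <;> rfl
  · rintro w ⟨i, j, hij⟩
    refine F.volH_eq_zero p w i ?_
    rw [hij]
    fin_cases j
    · exact hz 0
    · exact hz 1
    · exact hz 2

namespace Setup

variable [IsManifold (𝓡 5) ∞ M] {F : OrientedFibration M B} (T : Setup F) (p : M)

theorem conn_conn (x : Vec 5) : T.conn p (T.conn p x) = T.conn p x :=
  T.conn_proj p _ (T.conn_vertical p x)

theorem horLift_spec :
    (∀ u, F.dproj p (T.horLift p u) = u) ∧ ∀ u, T.conn p (T.horLift p u) = 0 := by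
  have hex : ∃ L : Vec 2 →L[ℝ] Vec 5,
      (∀ u, F.dproj p (L u) = u) ∧ ∀ u, T.conn p (L u) = 0 := by
    have hs : Function.Surjective (F.dproj p) := F.proj_submersion p
    obtain ⟨R, hR⟩ := (F.dproj p : Vec 5 →ₗ[ℝ] Vec 2).exists_rightInverse_of_surjective
      (LinearMap.range_eq_top.2 hs)
    have hR' : ∀ u, F.dproj p (R u) = u := fun u => congrArg (fun f => f u) hR
    let R' : Vec 2 →L[ℝ] Vec 5 := LinearMap.toContinuousLinearMap R
    -- Removing the vertical part of any right inverse of dπ makes it horizontal without changing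
    -- its projection.
    refine ⟨R' - (T.conn p).comp R', fun u => ?_, fun u => ?_⟩
    · change F.dproj p (R u - T.conn p (R u)) = u
      rw [map_sub, T.conn_vertical, hR', sub_zero]
    · change T.conn p (R u - T.conn p (R u)) = 0
      rw [map_sub, T.conn_conn, sub_self]
  exact Classical.epsilon_spec hex

theorem dproj_horLift (u : Vec 2) : F.dproj p (T.horLift p u) = u := (T.horLift_spec p).1 u

theorem conn_horLift (u : Vec 2) : T.conn p (T.horLift p u) = 0 := (T.horLift_spec p).2 u

theorem horLift_dproj (x : Vec 5) : T.horLift p (F.dproj p x) = x - T.conn p x := by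
  have h1 : F.dproj p (T.horLift p (F.dproj p x) - (x - T.conn p x)) = 0 := by
    rw [map_sub, map_sub, T.dproj_horLift, T.conn_vertical, sub_zero, sub_self]
  have h2 := T.conn_proj p _ h1
  rw [map_sub, map_sub, T.conn_horLift, T.conn_conn, sub_self, sub_zero] at h2
  exact sub_eq_zero.1 h2.symm

/-- A linear parametrization of the vertical subspace at `p` together with the corresponding
coordinates on the tangent space. -/
structure VerticalFrame where
  incl : Vec 3 →L[ℝ] Vec 5
  coord : Vec 5 →L[ℝ] Vec 3
  coord_incl : ∀ x, coord (incl x) = x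
  incl_coord : incl.comp coord = T.conn p

/-- The kernel of dπ has dimension 5 - 2 = 3; any isomorphism with ℝ³ serves, with γ followed by it
as coordinates. -/
theorem nonempty_verticalFrame : Nonempty (T.VerticalFrame p) := by
  let D : Vec 5 →ₗ[ℝ] Vec 2 := F.dproj p
  have hs : Function.Surjective D := F.proj_submersion p
  have hfin : Module.finrank ℝ (LinearMap.ker D) = Module.finrank ℝ (Vec 3) := by
    have h := D.finrank_range_add_finrank_ker
    rw [LinearMap.range_eq_top.2 hs, finrank_top] at h
    simp only [finrank_euclideanSpace, Fintype.card_fin] at h ⊢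
    omega
  let φ : LinearMap.ker D ≃L[ℝ] Vec 3 := ContinuousLinearEquiv.ofFinrankEq hfin
  refine ⟨(LinearMap.ker D).subtypeL.comp (φ.symm : Vec 3 →L[ℝ] LinearMap.ker D),
    (φ : LinearMap.ker D →L[ℝ] Vec 3).comp ((T.conn p).codRestrict (LinearMap.ker D)
      fun x => T.conn_vertical p x), fun x => ?_, ?_⟩
  · change φ ⟨T.conn p (φ.symm x), _⟩ = x
    refine Eq.trans (congrArg φ (Subtype.ext ?_)) (φ.apply_symm_apply x)
    exact T.conn_proj p _ (φ.symm x).2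
  · ext1 x
    change ((φ.symm (φ ⟨T.conn p x, _⟩) : LinearMap.ker D) : Vec 5) = _
    rw [φ.symm_apply_apply]

/-- The horizontal lift of the standard basis. -/
def horFrame (i : Fin 2) : Vec 5 := T.horLift p (basisVec i)

namespace VerticalFrame

variable {T p} (W : T.VerticalFrame p)

/-- The basis of the vertical subspace. -/
def vec (i : Fin 3) : Vec 5 := W.incl (basisVec i)

theorem conn_vec (i : Fin 3) : T.conn p (W.vec i) = W.vec i := by
  rw [← W.incl_coord]
  change W.incl (W.coord (W.incl _)) = _
  rw [W.coord_incl]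
  rfl

theorem dproj_vec (i : Fin 3) : F.dproj p (W.vec i) = 0 := by
  rw [← W.conn_vec, T.conn_vertical]

/-- The adapted frame. -/
def frame : Fin 5 → Vec 5 := ![T.horFrame p 0, T.horFrame p 1, W.vec 0, W.vec 1, W.vec 2]

/-- The adapted frame as a basis. -/
theorem exists_basis : ∃ b : Module.Basis (Fin 5) ℝ (Vec 5), ⇑b = W.frame := by
  have hli : LinearIndependent ℝ W.frame := by
    rw [Fintype.linearIndependent_iff]
    intro c hc
    have h1 := congrArg (F.dproj p) hc
    have hg : ∀ i, W.coord (T.horFrame p i) = 0 := by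
      intro i
      have h : W.incl (W.coord (T.horFrame p i)) = 0 := by
        change (W.incl.comp W.coord) _ = 0
        rw [W.incl_coord]
        exact T.conn_horLift p _
      rw [← W.coord_incl (W.coord (T.horFrame p i)), h, map_zero]
    have h2 := congrArg W.coord hc
    rw [Fin.sum_univ_five] at h1 h2
    simp only [frame, Matrix.cons_val_zero, Matrix.cons_val_one, Matrix.cons_val, map_add, map_smul,
      W.dproj_vec, smul_zero, add_zero, map_zero, hg, zero_add] at h1 h2
    simp only [horFrame, T.dproj_horLift, vec, W.coord_incl] at h1 h2
    have h10 := congrArg (fun x : Vec 2 => x 0) h1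
    have h11 := congrArg (fun x : Vec 2 => x 1) h1
    have h20 := congrArg (fun x : Vec 3 => x 0) h2
    have h21 := congrArg (fun x : Vec 3 => x 1) h2
    have h22 := congrArg (fun x : Vec 3 => x 2) h2
    simp [basisVec] at h10 h11 h20 h21 h22
    intro i
    fin_cases i <;> assumption
  refine ⟨basisOfLinearIndependentOfCardEqFinrank hli (by simp), ?_⟩
  simp

end VerticalFrame

theorem volH_horFrame : F.volH p (T.horFrame p) = F.areaCoeff (F.proj p) := by
  rw [F.volH_apply]
  simp only [horFrame, T.dproj_horLift]
  rfl

theorem volV_spec : comp (T.conn p) 0 (T.volV p) = T.volV p ∧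
    F.vol p = wedge (F.volH p) (T.volV p) := by
  have hex : ∃ a : Alt 5 3, comp (T.conn p) 0 a = a ∧ F.vol p = wedge (F.volH p) a := by
    obtain ⟨W⟩ := T.nonempty_verticalFrame p
    obtain ⟨b, hb⟩ := W.exists_basis
    -- Contract Ω with the horizontal frame, divide by Ω^H of that frame, and make the result
    -- vertical by precomposing with γ. Both sides of the required identity have top degree, so one
    -- comparison on the adapted basis suffices.
    let a : Alt 5 3 := (F.areaCoeff (F.proj p))⁻¹ •
      (((F.vol p).curryLeft (T.horFrame p 0)).curryLeft (T.horFrame p 1)).compContinuousLinearMap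
        (T.conn p)
    have ha : ∀ v, a v = (F.areaCoeff (F.proj p))⁻¹ * F.vol p (Matrix.vecCons (T.horFrame p 0)
        (Matrix.vecCons (T.horFrame p 1) fun i => T.conn p (v i))) := fun v => rfl
    refine ⟨a, ?_, ?_⟩
    · rw [comp_of_vertical _ (T.conn_conn p), if_pos rfl]
      intro v
      simp only [ha, T.conn_conn]
    -- The wedge product viewed in degree 5 instead of 2 + 3.
    · obtain ⟨τ, hτ⟩ : ∃ τ : Alt 5 5, τ = wedge (F.volH p) a := ⟨_, rfl⟩
      have hw : τ W.frame = F.volH p (T.horFrame p) * a W.vec := by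
        have h := F.wedge_volH p a (T.horFrame p) W.vec W.dproj_vec
        rw [← hτ] at h
        exact h
      refine Eq.trans ?_ hτ
      rw [← sub_eq_zero]
      refine eq_zero_of_basis b _ ?_
      rw [hb, ContinuousAlternatingMap.sub_apply, sub_eq_zero, hw]
      rw [T.volH_horFrame, ha, mul_inv_cancel_left₀ (F.areaCoeff_ne_zero _)]
      congr 1
      funext i
      fin_cases i <;> simp [VerticalFrame.frame, W.conn_vec]
  exact Classical.epsilon_spec hex

theorem volV_conn (v : Fin 3 → Vec 5) : T.volV p (fun i => T.conn p (v i)) = T.volV p v := by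
  have h := congrArg (fun a : Alt 5 3 => a v) (T.volV_spec p).1
  rwa [comp_zero_apply] at h

theorem volV_eq_zero (v : Fin 3 → Vec 5) (i : Fin 3) (hi : T.conn p (v i) = 0) :
    T.volV p v = 0 := by
  rw [← volV_conn]
  exact (T.volV p).map_coord_zero i hi

/-- Expresses the chosen form Ω^V through Ω, Ω^H and γ; this is how its smoothness is obtained
later. -/
theorem volH_mul_volV (x : Fin 2 → Vec 5) (y : Fin 3 → Vec 5) :
    F.volH p x * T.volV p y =
      F.vol p ![x 0, x 1, T.conn p (y 0), T.conn p (y 1), T.conn p (y 2)] := by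
  rw [← volV_conn, ← F.wedge_volH p _ x _ fun i => T.conn_vertical p (y i), ← (T.volV_spec p).2]

theorem vol_frame (W : T.VerticalFrame p) :
    F.vol p W.frame = F.areaCoeff (F.proj p) * T.volV p W.vec := by
  rw [← T.volH_horFrame, volH_mul_volV]
  simp only [W.conn_vec]
  rfl

theorem vol_frame_ne_zero (W : T.VerticalFrame p) : F.vol p W.frame ≠ 0 := by
  obtain ⟨b, hb⟩ := W.exists_basis
  intro h
  rw [← hb] at h
  exact F.vol_ne_zero p (eq_zero_of_basis b _ h)

theorem volV_vec_ne_zero (W : T.VerticalFrame p) : T.volV p W.vec ≠ 0 := by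
  intro h
  apply T.vol_frame_ne_zero p W
  rw [vol_frame, h, mul_zero]

theorem hor_psi : T.hor F.psi p = (F.areaCoeff (F.proj p))⁻¹ • decomp (T.horFrame p) := by
  rw [hor, F.psi_eq, pushMulti_smul_decomp]
  rfl

theorem QH_eq : T.QH p = (-(F.areaCoeff (F.proj p))⁻¹) • decomp (T.horFrame p) := by
  have h := epsilon_multiVec_eq (T.horLift p) (F.dproj p) (T.dproj_horLift p) (F.volH p) 1
    (-F.areaCoeff (F.proj p)) (neg_ne_zero.2 (F.areaCoeff_ne_zero _))
    (by rw [← T.volH_horFrame]; exact iterInt_two_self _ _)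
  have h2 : (T.horLift p).comp (F.dproj p) = ContinuousLinearMap.id ℝ (Vec 5) - T.conn p := by
    ext1 x
    exact T.horLift_dproj p x
  rw [h2, one_div, inv_neg] at h
  exact h

theorem QV_eq (W : T.VerticalFrame p) : T.QV p = (-(T.volV p W.vec)⁻¹) • decomp W.vec := by
  have h := epsilon_multiVec_eq W.incl W.coord W.coord_incl (T.volV p) 1
    (-T.volV p W.vec) (neg_ne_zero.2 (T.volV_vec_ne_zero p W)) (iterInt_three_self _ _)
  rw [W.incl_coord, one_div, inv_neg] at h
  exact h

theorem beta_conn (v : Fin 1 → Vec 5) : T.beta p (fun i => T.conn p (v i)) = T.beta p v := by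
  have h := T.beta_vertical p (v 0 - T.conn p (v 0)) (by rw [map_sub, T.conn_conn, sub_self])
  rw [apply_eq_toCov, map_sub, sub_eq_zero] at h
  rw [apply_eq_toCov, apply_eq_toCov _ v, h]

theorem d10_volV : d10 T.conn T.volV p = comp (T.conn p) 1 (extd T.volV p) :=
  extdShift_of_vertical _ T.conn_conn _ T.volV_conn 1 p

theorem d21_volV : d21 T.conn T.volV p = comp (T.conn p) 2 (extd T.volV p) :=
  extdShift_of_vertical _ T.conn_conn _ T.volV_conn 2 p

theorem d01_beta : d01 T.conn T.beta p = comp (T.conn p) 0 (extd T.beta p) :=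
  extdShift_of_vertical _ T.conn_conn _ T.beta_conn 0 p

theorem d10_kappa :
    d10 T.conn (zeroForm T.kappa) p = comp (T.conn p) 1 (extd (zeroForm T.kappa) p) :=
  extdShift_of_vertical _ T.conn_conn _ (fun _ _ => rfl) 1 p

end Setup

end

section

/-! ### The contraction identities -/

section Contraction

variable {n k : ℕ}

theorem curryLeft_covWedge (a : CoVec n) (α : Alt n (k + 1)) (x : Vec n) :
    (covWedge a α).curryLeft x = a x • α - covWedge a (α.curryLeft x) := by
  ext v
  exact covWedge_cons a α x v

theorem eq_zero_of_finrank_lt (h : n < k) (α : Alt n k) : α = 0 := by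
  ext v
  refine α.toAlternatingMap.map_linearDependent v fun hv => ?_
  have := hv.fintype_card_le_finrank
  simp at this
  omega

theorem covWedge_eq_zero_of_forall (a : CoVec n) (α : Alt n k) (v : Fin (k + 1) → Vec n)
    (h : ∀ i, a (v i) = 0) : covWedge a α v = 0 := by
  rw [covWedge_apply]
  exact Finset.sum_eq_zero fun i _ => by rw [h, zero_mul, mul_zero]

/-- Apply i_x to c ∧ α, which is zero for degree reasons. It reads the value c(x) off the
contraction i_x Ω. -/
theorem covWedge_curryLeft_top (hk : n < k + 2) (c : CoVec n) (α : Alt n (k + 1)) (x : Vec n)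
    (v : Fin (k + 1) → Vec n) : covWedge c (α.curryLeft x) v = c x * α v := by
  have h := covWedge_cons c α x v
  rw [eq_zero_of_finrank_lt hk (covWedge c α)] at h
  exact (sub_eq_zero.1 h.symm).symm

theorem covWedge_covWedge_cons_cons (c a : CoVec n) (α : Alt n (k + 1)) (x y : Vec n)
    (v : Fin (k + 1) → Vec n) (hx : α.curryLeft x = 0) (hy : α.curryLeft y = 0) :
    covWedge c (covWedge a α) (Matrix.vecCons x (Matrix.vecCons y v)) =
      (c x * a y - a x * c y) * α v := by
  have h0 : ∀ b : CoVec n, covWedge b (0 : Alt n k) = 0 := fun b => by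
    simpa using covWedge_smul b 0 (0 : Alt n k)
  rw [covWedge_cons, covWedge_cons, curryLeft_covWedge, hx, hy, h0, sub_zero, covWedge_smul]
  rw [ContinuousAlternatingMap.smul_apply, covWedge_cons, hy, h0]
  simp
  ring

theorem covWedge_covWedge_eval (p q : CoVec n) (δ : Alt n (k + 1)) (x y : Vec n)
    (v : Fin (k + 1) → Vec n) (hpx : p x = 1) (hpy : p y = 0) (hqx : q x = 0) (hqy : q y = 1)
    (hp : ∀ i, p (v i) = 0) (hq : ∀ i, q (v i) = 0) :
    covWedge p (covWedge q δ) (Matrix.vecCons x (Matrix.vecCons y v)) = δ v := by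
  rw [covWedge_cons, covWedge_cons, covWedge_eq_zero_of_forall q _ v hq, curryLeft_covWedge, hqx,
    hpx, hqy, zero_smul, zero_sub, covWedge_neg, ContinuousAlternatingMap.neg_apply, covWedge_cons,
    hpy, covWedge_eq_zero_of_forall p _ v hp]
  ring

theorem covWedge_apply_three (c : CoVec n) (γ : Alt n 2) (e : Fin 3 → Vec n) :
    covWedge c γ e = c (e 0) * γ ![e 1, e 2] - c (e 1) * γ ![e 0, e 2] + c (e 2) * γ ![e 0, e 1] := by
  rw [covWedge_apply, Fin.sum_univ_three]
  have h0 : (0 : Fin 3).removeNth e = ![e 1, e 2] := by ext i : 1; fin_cases i <;> rfl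
  have h1 : (1 : Fin 3).removeNth e = ![e 0, e 2] := by ext i : 1; fin_cases i <;> rfl
  have h2 : (2 : Fin 3).removeNth e = ![e 0, e 1] := by ext i : 1; fin_cases i <;> rfl
  rw [h0, h1, h2]
  norm_num
  ring

theorem covWedge_apply_five (c : CoVec n) (A : Alt n 4) (x y z₀ z₁ z₂ : Vec n) :
    covWedge c A ![x, y, z₀, z₁, z₂] = c x * A ![y, z₀, z₁, z₂] - c y * A ![x, z₀, z₁, z₂] +
      c z₀ * A ![x, y, z₁, z₂] - c z₁ * A ![x, y, z₀, z₂] + c z₂ * A ![x, y, z₀, z₁] := by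
  rw [covWedge_apply, Fin.sum_univ_five]
  have h0 : (0 : Fin 5).removeNth ![x, y, z₀, z₁, z₂] = ![y, z₀, z₁, z₂] := by
    ext i : 1; fin_cases i <;> rfl
  have h1 : (1 : Fin 5).removeNth ![x, y, z₀, z₁, z₂] = ![x, z₀, z₁, z₂] := by
    ext i : 1; fin_cases i <;> rfl
  have h2 : (2 : Fin 5).removeNth ![x, y, z₀, z₁, z₂] = ![x, y, z₁, z₂] := by
    ext i : 1; fin_cases i <;> rfl
  have h3 : (3 : Fin 5).removeNth ![x, y, z₀, z₁, z₂] = ![x, y, z₀, z₂] := by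
    ext i : 1; fin_cases i <;> rfl
  have h4 : (4 : Fin 5).removeNth ![x, y, z₀, z₁, z₂] = ![x, y, z₀, z₁] := by
    ext i : 1; fin_cases i <;> rfl
  rw [h0, h1, h2, h3, h4]
  simp only [Fin.val_zero, Fin.val_one, Matrix.cons_val_zero, Matrix.cons_val_one, Matrix.cons_val,
    Fin.val_two, show ((3 : Fin 5) : ℕ) = 3 from rfl,
    show ((4 : Fin 5) : ℕ) = 4 from rfl]
  ring

theorem apply_swap_two (a : Alt n 2) (x y : Vec n) : a ![y, x] = -a ![x, y] := by
  have := a.map_swap ![x, y] (i := 0) (j := 1) (by decide)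
  refine Eq.trans ?_ this
  change a _ = a _
  congr 1
  funext i
  fin_cases i <;> rfl

theorem apply_swap_four_left (a : Alt n 4) (x y z t : Vec n) :
    a ![y, x, z, t] = -a ![x, y, z, t] := by
  have := a.map_swap ![x, y, z, t] (i := 0) (j := 1) (by decide)
  refine Eq.trans ?_ this
  change a _ = a _
  congr 1
  funext i
  fin_cases i <;> rfl

theorem apply_swap_four_right (a : Alt n 4) (x y z t : Vec n) :
    a ![x, y, t, z] = -a ![x, y, z, t] := by
  have := a.map_swap ![x, y, z, t] (i := 2) (j := 3) (by decide)
  refine Eq.trans ?_ this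
  change a _ = a _
  congr 1
  funext i
  fin_cases i <;> rfl

theorem apply_reverse_four (a : Alt n 4) (x y z t : Vec n) :
    a ![t, z, y, x] = a ![x, y, z, t] := by
  have := a.toAlternatingMap.map_perm ![x, y, z, t] Fin.revPerm
  rw [show Equiv.Perm.sign (Fin.revPerm : Equiv.Perm (Fin 4)) = 1 by decide, one_smul] at this
  refine Eq.trans ?_ this
  change a _ = a _
  congr 1
  funext i
  fin_cases i <;> rfl

theorem covWedge_three_eval (c a b : CoVec n) (H : Alt n 2) (x y z₀ z₁ z₂ : Vec n)
    (h₀ : H.curryLeft z₀ = 0) (h₁ : H.curryLeft z₁ = 0) (h₂ : H.curryLeft z₂ = 0) :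
    covWedge c (covWedge a (covWedge b H)) ![x, y, z₀, z₁, z₂] =
      Matrix.det !![c z₀, c z₁, c z₂; a z₀, a z₁, a z₂; b z₀, b z₁, b z₂] * H ![x, y] := by
  have h0 : ∀ b : CoVec n, covWedge b (0 : Alt n 1) = 0 := fun b => by
    simpa using covWedge_smul b 0 (0 : Alt n 1)
  -- An even rotation brings the vectors that annihilate `H` to the front, so that they can only be
  -- absorbed by the three covectors.
  have hp := (covWedge c (covWedge a (covWedge b H))).toAlternatingMap.map_perm
    ![z₀, z₁, z₂, x, y] (finRotate 5 ^ 3)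
  rw [show Equiv.Perm.sign (finRotate 5 ^ 3) = 1 by decide, one_smul] at hp
  have hp2 : covWedge c (covWedge a (covWedge b H)) ![x, y, z₀, z₁, z₂] =
      covWedge c (covWedge a (covWedge b H)) ![z₀, z₁, z₂, x, y] := by
    refine Eq.trans ?_ hp
    change covWedge _ _ _ = covWedge _ _ _
    congr 1
    funext i
    fin_cases i <;> rfl
  rw [hp2]
  simp only [covWedge_cons, curryLeft_covWedge, h₀, h₁, h₂, h0, sub_zero, covWedge_sub, covWedge_smul,
    ContinuousAlternatingMap.sub_apply, ContinuousAlternatingMap.smul_apply, smul_eq_mul,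
    ContinuousAlternatingMap.coe_zero, Pi.zero_apply, Matrix.det_fin_three, Matrix.of_apply,
    Matrix.cons_val', Matrix.cons_val_zero, Matrix.cons_val_one, Matrix.cons_val]
  ring

end Contraction

variable {M B : Type*}
  [TopologicalSpace M] [ChartedSpace (EuclideanSpace ℝ (Fin 5)) M]
  [TopologicalSpace B] [ChartedSpace (EuclideanSpace ℝ (Fin 2)) B]

namespace Setup

variable [IsManifold (𝓡 5) ∞ M] {F : OrientedFibration M B} (T : Setup F) (p : M)

/-- The form `i_Π Ω`. -/
def sigma : Form 5 M 3 := fun p =>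
  -(T.kappa p • T.volV p) - covWedge (toCov (T.beta p)) (F.volH p)

theorem VerticalFrame.frame_eq {p : M} (W : T.VerticalFrame p) :
    W.frame = Matrix.vecCons (T.horFrame p 0) (Matrix.vecCons (T.horFrame p 1) W.vec) := by
  funext i
  fin_cases i <;> rfl

theorem curryLeft_volV_horFrame (i : Fin 2) : (T.volV p).curryLeft (T.horFrame p i) = 0 := by
  ext v
  exact T.volV_eq_zero p _ 0 (T.conn_horLift p _)

theorem curryLeft_volH_vec (W : T.VerticalFrame p) (i : Fin 3) :
    (F.volH p).curryLeft (W.vec i) = 0 := by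
  ext v
  exact F.volH_eq_zero p _ 0 (W.dproj_vec i)

/-- The factor on the left is Ω on the adapted frame; it clears the denominators of ψ and Q_V. The
determinant is the contribution of -i_β Q_V. -/
theorem apply_sharp_tensor (W : T.VerticalFrame p) (α : Form 5 M 1) (c : CoVec 5) :
    F.areaCoeff (F.proj p) * T.volV p W.vec * c (sharp T.tensor α p) =
      T.kappa p * T.volV p W.vec *
        (toCov (α p) (T.horFrame p 0) * c (T.horFrame p 1) -
          toCov (α p) (T.horFrame p 1) * c (T.horFrame p 0)) +
      F.areaCoeff (F.proj p) * Matrix.det !![c (W.vec 0), c (W.vec 1), c (W.vec 2);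
        toCov (T.beta p) (W.vec 0), toCov (T.beta p) (W.vec 1), toCov (T.beta p) (W.vec 2);
        toCov (α p) (W.vec 0), toCov (α p) (W.vec 1), toCov (α p) (W.vec 2)] := by
  have hw := F.areaCoeff_ne_zero (F.proj p)
  have hv := T.volV_vec_ne_zero p W
  rw [sharp, apply_toVec_intForm_one, tensor, Pbeta, T.hor_psi, T.QV_eq p W]
  rw [ContinuousAlternatingMap.add_apply, ContinuousAlternatingMap.neg_apply, intForm_one_apply]
  simp only [ContinuousAlternatingMap.smul_apply, smul_eq_mul, decomp_apply, Matrix.det_fin_three,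
    Matrix.det_fin_two, Matrix.of_apply,
    Matrix.cons_val', Matrix.cons_val_zero, Matrix.cons_val_one, Matrix.cons_val]
  field_simp
  ring

/-- Both sides have codegree one, so it is enough to wedge with an arbitrary covector c and evaluate
on the adapted basis; the left side then becomes Ω(frame) · c(Π^♯α). -/
theorem curryLeft_sharp_tensor (α : Form 5 M 1) :
    (F.vol p).curryLeft (sharp T.tensor α p) = covWedge (toCov (α p)) (T.sigma p) := by
  obtain ⟨W⟩ := T.nonempty_verticalFrame p
  obtain ⟨b, hb⟩ := W.exists_basis
  rw [← sub_eq_zero]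
  refine eq_zero_of_covWedge b _ fun c => ?_
  rw [covWedge_sub, ContinuousAlternatingMap.sub_apply, sub_eq_zero,
    covWedge_curryLeft_top (by norm_num) c (F.vol p), hb, T.vol_frame p W, mul_comm,
    T.apply_sharp_tensor p W α c, sigma, covWedge_sub, covWedge_neg, covWedge_smul, covWedge_sub,
    covWedge_neg, covWedge_smul, ContinuousAlternatingMap.sub_apply,
    ContinuousAlternatingMap.neg_apply, ContinuousAlternatingMap.smul_apply, smul_eq_mul]
  have h1 : covWedge c (covWedge (toCov (α p)) (T.volV p)) W.frame = _ :=
    W.frame_eq ▸ covWedge_covWedge_cons_cons c (toCov (α p)) (T.volV p) (T.horFrame p 0) (T.horFrame p 1) W.vec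
      (T.curryLeft_volV_horFrame p 0) (T.curryLeft_volV_horFrame p 1)
  have h2 : covWedge c (covWedge (toCov (α p)) (covWedge (toCov (T.beta p)) (F.volH p))) W.frame = _ :=
    covWedge_three_eval c (toCov (α p)) (toCov (T.beta p)) (F.volH p) (T.horFrame p 0)
      (T.horFrame p 1) _ _ _ (T.curryLeft_volH_vec p W 0) (T.curryLeft_volH_vec p W 1)
      (T.curryLeft_volH_vec p W 2)
  have h3 : F.volH p ![T.horFrame p 0, T.horFrame p 1] = F.areaCoeff (F.proj p) := by
    rw [← T.volH_horFrame]
    congr 1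
    funext i
    fin_cases i <;> rfl
  rw [h1, h2, h3]
  simp only [Matrix.det_fin_three, Matrix.of_apply, Matrix.cons_val', Matrix.cons_val_zero,
    Matrix.cons_val_one, Matrix.cons_val]
  ring

end Setup

end

/-! ### θ, ϱ and the two parts of Z on an adapted frame -/

section

variable {M B : Type*}
  [TopologicalSpace M] [ChartedSpace (EuclideanSpace ℝ (Fin 5)) M]
  [TopologicalSpace B] [ChartedSpace (EuclideanSpace ℝ (Fin 2)) B]

namespace Setup

variable [IsManifold (𝓡 5) ∞ M] {F : OrientedFibration M B} (T : Setup F) (p : M)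

/-- The minus signs in θ and in Q_V cancel, and reversing four arguments is even. -/
theorem toCov_theta_horFrame (W : T.VerticalFrame p) (i : Fin 2) :
    T.volV p W.vec * toCov (T.theta p) (T.horFrame p i) =
      extd T.volV p ![T.horFrame p i, W.vec 0, W.vec 1, W.vec 2] := by
  have hv := T.volV_vec_ne_zero p W
  have h1 : iterInt 3 W.vec (comp (T.conn p) 1 (extd T.volV p)) (fun _ : Fin 1 => T.horFrame p i) =
      extd T.volV p ![W.vec 2, W.vec 1, W.vec 0, T.horFrame p i] := by
    rw [iterInt_apply]
    have h2 : revAppend W.vec (fun _ : Fin 1 => T.horFrame p i) =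
        ![W.vec 2, W.vec 1, W.vec 0, T.horFrame p i] := by
      funext j
      fin_cases j <;> rfl
    rw [h2]
    -- The vertical vectors have been inserted in front, so the only horizontal slot is the last.
    refine comp_apply_adapted (T.conn p) _ _ ({3} : Finset (Fin 4)) ?_ ?_
    · intro j hj
      rw [Finset.mem_singleton] at hj
      subst hj
      exact T.conn_horLift p _
    · intro j hj
      fin_cases j
      · exact W.conn_vec 2
      · exact W.conn_vec 1
      · exact W.conn_vec 0
      · exact absurd (Finset.mem_singleton_self _) hj
  rw [toCov_apply, theta, ContinuousAlternatingMap.neg_apply, d10_volV, T.QV_eq p W,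
    intMulti_smul_decomp, h1, apply_reverse_four, neg_mul, neg_neg, mul_inv_cancel_left₀ hv]

/-- The minus sign of Q_H cancels against the swap of the two horizontal vectors caused by the
reversed insertion. -/
theorem rho_vec (W : T.VerticalFrame p) (i j : Fin 3) :
    F.areaCoeff (F.proj p) * T.rho p ![W.vec i, W.vec j] =
      extd T.volV p ![T.horFrame p 0, T.horFrame p 1, W.vec i, W.vec j] := by
  have hw := F.areaCoeff_ne_zero (F.proj p)
  have h1 : iterInt 2 (T.horFrame p) (comp (T.conn p) 2 (extd T.volV p)) ![W.vec i, W.vec j] =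
      extd T.volV p ![T.horFrame p 1, T.horFrame p 0, W.vec i, W.vec j] := by
    rw [iterInt_apply]
    have h2 : revAppend (T.horFrame p) ![W.vec i, W.vec j] =
        ![T.horFrame p 1, T.horFrame p 0, W.vec i, W.vec j] := by
      funext j
      fin_cases j <;> rfl
    rw [h2]
    refine comp_apply_adapted (T.conn p) _ _ ({0, 1} : Finset (Fin 4)) ?_ ?_
    · intro j hj
      rw [Finset.mem_insert, Finset.mem_singleton] at hj
      rcases hj with rfl | rfl <;> exact T.conn_horLift p _
    · intro j hj
      fin_cases j
      · exact absurd (by decide) hj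
      · exact absurd (by decide) hj
      · exact W.conn_vec _
      · exact W.conn_vec _
  rw [rho, d21_volV, T.QH_eq, intMulti_smul_decomp, h1, apply_swap_four_left]
  field_simp

theorem d01_beta_vec (W : T.VerticalFrame p) (i j : Fin 3) :
    d01 T.conn T.beta p ![W.vec i, W.vec j] = extd T.beta p ![W.vec i, W.vec j] := by
  rw [d01_beta, comp_zero_apply]
  congr 1
  funext k
  fin_cases k <;> exact W.conn_vec _

theorem d10_kappa_horFrame (i : Fin 2) :
    toCov (d10 T.conn (zeroForm T.kappa) p) (T.horFrame p i) =
      toCov (extd (zeroForm T.kappa) p) (T.horFrame p i) := by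
  rw [toCov_apply, d10_kappa]
  refine comp_apply_adapted (T.conn p) _ _ (Finset.univ : Finset (Fin 1)) ?_ ?_
  · intro j _
    exact T.conn_horLift p _
  · intro j hj
    exact absurd (Finset.mem_univ _) hj

/-- Again multiplied by Ω(frame). On frame vectors the bigraded derivatives become values of the
full differentials dΩ^V and dκ, which is the form in which they occur in dσ. -/
theorem apply_Z10 (W : T.VerticalFrame p) (c : CoVec 5) :
    F.areaCoeff (F.proj p) * T.volV p W.vec * c (T.Z10 p) =
      (T.kappa p * extd T.volV p ![T.horFrame p 1, W.vec 0, W.vec 1, W.vec 2] +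
        T.volV p W.vec * toCov (extd (zeroForm T.kappa) p) (T.horFrame p 1)) * c (T.horFrame p 0) -
      (T.kappa p * extd T.volV p ![T.horFrame p 0, W.vec 0, W.vec 1, W.vec 2] +
        T.volV p W.vec * toCov (extd (zeroForm T.kappa) p) (T.horFrame p 0)) *
          c (T.horFrame p 1) := by
  have hw := F.areaCoeff_ne_zero (F.proj p)
  have hc : ∀ i, toCov (T.kappa p • T.theta p + d10 T.conn (zeroForm T.kappa) p) (T.horFrame p i) =
      T.kappa p * toCov (T.theta p) (T.horFrame p i) +
        toCov (extd (zeroForm T.kappa) p) (T.horFrame p i) := by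
    intro i
    rw [← d10_kappa_horFrame]
    rfl
  rw [Z10, map_neg, apply_toVec_intForm_one, T.hor_psi, ← T.toCov_theta_horFrame p W 0,
    ← T.toCov_theta_horFrame p W 1]
  simp only [ContinuousAlternatingMap.smul_apply, smul_eq_mul, decomp_apply,
    Matrix.det_fin_two, Matrix.of_apply, Matrix.cons_val_zero, Matrix.cons_val_one, hc]
  field_simp
  ring

theorem apply_Z01 (W : T.VerticalFrame p) (c : CoVec 5) :
    F.areaCoeff (F.proj p) * T.volV p W.vec * c (T.Z01 p) =
      (F.areaCoeff (F.proj p) * extd T.beta p ![W.vec 1, W.vec 2] + T.kappa p *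
        extd T.volV p ![T.horFrame p 0, T.horFrame p 1, W.vec 1, W.vec 2]) * c (W.vec 0) +
      (F.areaCoeff (F.proj p) * extd T.beta p ![W.vec 2, W.vec 0] + T.kappa p *
        extd T.volV p ![T.horFrame p 0, T.horFrame p 1, W.vec 2, W.vec 0]) * c (W.vec 1) +
      (F.areaCoeff (F.proj p) * extd T.beta p ![W.vec 0, W.vec 1] + T.kappa p *
        extd T.volV p ![T.horFrame p 0, T.horFrame p 1, W.vec 0, W.vec 1]) * c (W.vec 2) := by
  have hv := T.volV_vec_ne_zero p W
  simp only [← rho_vec]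
  rw [Z01, T.QV_eq p W, apply_toVec_intForm_two]
  simp only [ContinuousAlternatingMap.add_apply, ContinuousAlternatingMap.smul_apply, smul_eq_mul,
    d01_beta_vec]
  field_simp

/-- The contraction of the volume form with the modular vector field, in terms of the exterior
derivative of `i_Π Ω`. -/
theorem curryLeft_Z_of_extd_sigma (dw : CoVec 5) (hdw : ∀ x, F.dproj p x = 0 → dw x = 0)
    (h : extd T.sigma p =
      -(covWedge (toCov (extd (zeroForm T.kappa) p)) (T.volV p) + T.kappa p • extd T.volV p) -
        covWedge ((basisCoVec 0).comp (F.dproj p)) (covWedge ((basisCoVec 1).comp (F.dproj p))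
          (covWedge dw (T.beta p) + F.areaCoeff (F.proj p) • extd T.beta p))) :
    (F.vol p).curryLeft (T.Z10 p + T.Z01 p) = -extd T.sigma p := by
  obtain ⟨W⟩ := T.nonempty_verticalFrame p
  obtain ⟨b, hb⟩ := W.exists_basis
  rw [← sub_eq_zero]
  refine eq_zero_of_covWedge b _ fun c => ?_
  rw [covWedge_sub, ContinuousAlternatingMap.sub_apply, sub_eq_zero,
    covWedge_curryLeft_top (by norm_num) c (F.vol p), hb, T.vol_frame p W, mul_comm, map_add,
    mul_add, T.apply_Z10 p W, T.apply_Z01 p W, h, covWedge_neg, covWedge_sub, covWedge_neg,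
    covWedge_add c, covWedge_smul c]
  -- Moving c past dx ∧ dy costs no sign; with dx ∧ dy in front, evaluation on the frame uses up h₀,
  -- h₁ and leaves the vertical vectors (`h3`).
  have hpi : ∀ α : Alt 5 2, covWedge c (covWedge ((basisCoVec 0).comp (F.dproj p))
      (covWedge ((basisCoVec 1).comp (F.dproj p)) α)) =
      covWedge ((basisCoVec 0).comp (F.dproj p)) (covWedge ((basisCoVec 1).comp (F.dproj p))
        (covWedge c α)) := by
    intro α
    rw [covWedge_covWedge_comm c, covWedge_covWedge_comm c, covWedge_neg, neg_neg]
  rw [hpi]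
  have h1 : covWedge c (covWedge (toCov (extd (zeroForm T.kappa) p)) (T.volV p)) W.frame = _ :=
    W.frame_eq ▸ covWedge_covWedge_cons_cons c (toCov (extd (zeroForm T.kappa) p)) (T.volV p)
      (T.horFrame p 0) (T.horFrame p 1) W.vec
      (T.curryLeft_volV_horFrame p 0) (T.curryLeft_volV_horFrame p 1)
  have h2 : covWedge c (extd T.volV p) W.frame = _ := covWedge_apply_five c _ _ _ _ _ _
  have h3 : ∀ δ : Alt 5 3, covWedge ((basisCoVec 0).comp (F.dproj p))
      (covWedge ((basisCoVec 1).comp (F.dproj p)) δ) W.frame = δ W.vec := by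
    intro δ
    rw [W.frame_eq]
    refine covWedge_covWedge_eval _ _ _ _ _ _ ?_ ?_ ?_ ?_ ?_ ?_ <;>
      simp [horFrame, T.dproj_horLift, W.dproj_vec, basisVec]
  -- This is where the variation of the area coefficient disappears: dw vanishes on vertical
  -- vectors.
  have h4 : ∀ i j, covWedge dw (T.beta p) ![W.vec i, W.vec j] = 0 := by
    intro i j
    refine covWedge_eq_zero_of_forall _ _ _ fun k => hdw _ ?_
    fin_cases k <;> exact W.dproj_vec _
  simp only [ContinuousAlternatingMap.neg_apply, ContinuousAlternatingMap.sub_apply,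
    ContinuousAlternatingMap.add_apply, ContinuousAlternatingMap.smul_apply, h1, h2, h3, smul_eq_mul]
  rw [covWedge_apply_three]
  simp only [ContinuousAlternatingMap.add_apply, ContinuousAlternatingMap.smul_apply, h4, smul_eq_mul]
  rw [apply_swap_two _ (W.vec 0) (W.vec 2), apply_swap_four_right _ _ _ (W.vec 0) (W.vec 2)]
  ring

theorem conn_Z10 : T.conn p (T.Z10 p) = 0 := by
  have h : ∀ c : CoVec 5, c (T.conn p (T.Z10 p)) = 0 := by
    intro c
    change (c.comp (T.conn p)) (T.Z10 p) = 0
    have hh : ∀ i, T.conn p (T.horFrame p i) = 0 := fun i => T.conn_horLift p _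
    rw [Z10, map_neg, apply_toVec_intForm_one, T.hor_psi]
    simp [decomp_apply, Matrix.det_fin_two, hh]
  ext i
  exact h (basisCoVec i)

theorem dproj_Z01 : F.dproj p (T.Z01 p) = 0 := by
  obtain ⟨W⟩ := T.nonempty_verticalFrame p
  have h : ∀ c : CoVec 2, c (F.dproj p (T.Z01 p)) = 0 := by
    intro c
    change (c.comp (F.dproj p)) (T.Z01 p) = 0
    rw [Z01, T.QV_eq p W, apply_toVec_intForm_two]
    simp [W.dproj_vec]
  ext i
  exact h (basisCoVec i)

end Setup

end

/-! ### Calculus of forms on the model space -/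

section Calculus

variable {n k : ℕ} {E : Type*} [NormedAddCommGroup E] [NormedSpace ℝ E]

theorem contDiff_curryLeft (n k : ℕ) (m : WithTop ℕ∞) :
    ContDiff ℝ m fun a : Alt n (k + 1) => a.curryLeft := by
  let L : Alt n (k + 1) →L[ℝ] Vec n →L[ℝ] Alt n k :=
    LinearIsometry.toContinuousLinearMap
      (ContinuousAlternatingMap.curryLeftLI (𝕜 := ℝ) (E := Vec n) (F := ℝ) (n := k))
  exact ContinuousLinearMap.contDiff (𝕜 := ℝ) (E := Alt n (k + 1)) (F := Vec n →L[ℝ] Alt n k) L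

theorem contDiff_alternatizeUncurryFin (n k : ℕ) (m : WithTop ℕ∞) :
    ContDiff ℝ m fun a : Vec n →L[ℝ] Alt n k => ContinuousAlternatingMap.alternatizeUncurryFin a := by
  let L : (Vec n →L[ℝ] Alt n k) →L[ℝ] Alt n (k + 1) :=
    ContinuousAlternatingMap.alternatizeUncurryFinCLM ℝ (Vec n) ℝ
  exact ContinuousLinearMap.contDiff (𝕜 := ℝ) (E := Vec n →L[ℝ] Alt n k) (F := Alt n (k + 1)) L

theorem contDiffAt_clm_of_apply {G : Type*} [NormedAddCommGroup G] [NormedSpace ℝ G]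
    {m : WithTop ℕ∞} {x : E} {f : E → Vec n →L[ℝ] G}
    (h : ∀ v, ContDiffAt ℝ m (fun y => f y v) x) : ContDiffAt ℝ m f x := by
  have h1 : f = fun y => ∑ i : Fin n, (basisCoVec i).smulRight (f y (basisVec i)) := by
    funext y
    ext1 v
    conv_lhs => rw [← sum_smul_basisVec v]
    simp [sum_apply]
  rw [h1]
  exact ContDiffAt.sum fun i _ => contDiffAt_const.smulRight (h _)

theorem contDiffAt_alt_apply {m : WithTop ℕ∞} {x : E} : ∀ {k : ℕ} {α : E → Alt n k}
    {v : Fin k → E → Vec n}, ContDiffAt ℝ m α x → (∀ i, ContDiffAt ℝ m (v i) x) →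
    ContDiffAt ℝ m (fun y => α y fun i => v i y) x
  | 0, α, v, hα, _ => by
    have h : (fun y => α y fun i => v i y) = fun y =>
        (ContinuousAlternatingMap.constOfIsEmptyLIE ℝ (Vec n) ℝ (Fin 0)).symm (α y) := by
      funext y
      rw [ContinuousAlternatingMap.constOfIsEmptyLIE_symm_apply]
      congr 1
      exact Subsingleton.elim _ _
    rw [h]
    exact (ContinuousAlternatingMap.constOfIsEmptyLIE ℝ (Vec n) ℝ (Fin 0)).symm.contDiff.contDiffAt.comp x hα
  | k + 1, α, v, hα, hv => by
    have h1 : ContDiffAt ℝ m (fun y => (α y).curryLeft) x :=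
      (contDiff_curryLeft n k m).contDiffAt.comp x hα
    have h2 : ContDiffAt ℝ m (fun y => (α y).curryLeft (v 0 y)) x := h1.clm_apply (hv 0)
    refine (contDiffAt_alt_apply h2 fun i => hv i.succ).congr_of_eventuallyEq (.of_forall fun y => ?_)
    change α y _ = α y _
    congr 1
    funext i
    refine Fin.cases ?_ (fun i => ?_) i <;> rfl

/-- Induction on the degree by currying. Alternating the curried form returns (k + 1) times the
form, whence the inverse factor in the inductive step. -/
theorem contDiffAt_alt_of_apply {m : WithTop ℕ∞} {x : E} : ∀ {k : ℕ} {α : E → Alt n k},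
    (∀ v, ContDiffAt ℝ m (fun y => α y v) x) → ContDiffAt ℝ m α x
  | 0, α, h => by
    refine ((ContinuousAlternatingMap.constOfIsEmptyLIE ℝ (Vec n) ℝ (Fin 0)).contDiff.contDiffAt.comp x
      (h 0)).congr_of_eventuallyEq (.of_forall fun y => ?_)
    ext v
    simp [Subsingleton.elim v 0]
  | k + 1, α, h => by
    have h1 : ContDiffAt ℝ m (fun y => (α y).curryLeft) x := by
      refine contDiffAt_clm_of_apply fun z => ?_
      exact contDiffAt_alt_of_apply fun v => h (Matrix.vecCons z v)
    refine (contDiffAt_const (c := ((k : ℝ) + 1)⁻¹).smul ((contDiff_alternatizeUncurryFin n k m).contDiffAt.comp x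
      h1)).congr_of_eventuallyEq (.of_forall fun y => ?_)
    have hk : (k : ℝ) + 1 ≠ 0 := by positivity
    have h2 := ContinuousAlternatingMap.alternatizeUncurryFin_curryLeft (α y)
    ext v
    have h3 := congrArg (fun a : Alt n (k + 1) => a v) h2
    simp at h3
    simp
    field_simp

theorem contDiffAt_covWedge {m : WithTop ℕ∞} {x : E} {a : E → CoVec n} {α : E → Alt n k}
    (ha : ContDiffAt ℝ m a x) (hα : ContDiffAt ℝ m α x) :
    ContDiffAt ℝ m (fun y => covWedge (a y) (α y)) x :=
  (contDiff_alternatizeUncurryFin n k m).contDiffAt.comp x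
    (ha.smulRight hα)

theorem contDiffAt_extDeriv {α : Vec n → Alt n k} {x : Vec n} (hα : ContDiffAt ℝ ∞ α x) :
    ContDiffAt ℝ ∞ (extDeriv α) x :=
  (contDiff_alternatizeUncurryFin n k ∞).contDiffAt.comp x
    (hα.fderiv_right (by simp))

theorem extDeriv_smul_fun {f : Vec n → ℝ} {α : Vec n → Alt n k} {x : Vec n}
    (hf : DifferentiableAt ℝ f x) (hα : DifferentiableAt ℝ α x) :
    extDeriv (fun y => f y • α y) x = covWedge (fderiv ℝ f x) (α x) + f x • extDeriv α x := by
  rw [extDeriv, fderiv_fun_smul hf hα, ContinuousAlternatingMap.alternatizeUncurryFin_add,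
    ContinuousAlternatingMap.alternatizeUncurryFin_smul]
  exact add_comm _ _

/-- Write df ∧ α = d(fα) - f dα near x and use d² = 0 on both fα and α. -/
theorem extDeriv_covWedge_fderiv {f : Vec n → ℝ} {α : Vec n → Alt n k} {x : Vec n}
    (hf : ContDiffAt ℝ ∞ f x) (hα : ContDiffAt ℝ ∞ α x) :
    extDeriv (fun y => covWedge (fderiv ℝ f y) (α y)) x =
      -covWedge (fderiv ℝ f x) (extDeriv α x) := by
  have hdα := contDiffAt_extDeriv hα
  have hfα := contDiffAt_extDeriv (hf.smul hα)
  have h1 : (1 : WithTop ℕ∞) ≤ ∞ := by exact_mod_cast le_top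
  have h0 : (1 : WithTop ℕ∞) ≠ 0 := one_ne_zero
  have hev : (fun y => covWedge (fderiv ℝ f y) (α y)) =ᶠ[nhds x]
      fun y => extDeriv (fun y => f y • α y) y + (-f y) • extDeriv α y := by
    filter_upwards [(hf.of_le h1).eventually (by simp), (hα.of_le h1).eventually (by simp)]
      with y hy hy'
    rw [extDeriv_smul_fun (hy.differentiableAt h0) (hy'.differentiableAt h0)]
    simp
  have hi : (∞ : WithTop ℕ∞) ≠ 0 := by simp
  have hm : minSmoothness ℝ 2 ≤ ∞ := by
    rw [minSmoothness_of_isRCLikeNormedField]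
    exact WithTop.coe_le_coe.2 le_top
  rw [hev.extDeriv_eq, extDeriv_fun_add, extDeriv_smul_fun,
    extDeriv_extDeriv_apply hα hm]
  · have := extDeriv_extDeriv_apply (hf.smul hα) hm
    change extDeriv (extDeriv fun y => f y • α y) x = 0 at this
    rw [this, fderiv_fun_neg]
    ext v
    simp [covWedge_apply, Finset.sum_neg_distrib]
  · exact hf.neg.differentiableAt hi
  · exact hdα.differentiableAt hi
  · exact hfα.differentiableAt hi
  · exact (hf.neg.smul hdα).differentiableAt hi

end Calculus

/-! ### Forms in charts -/

section Charts

variable {n : ℕ} {M : Type*} [TopologicalSpace M] [ChartedSpace (EuclideanSpace ℝ (Fin n)) M]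

/-- The tangent map of the preferred chart at `p`. -/
def chartDeriv (p q : M) : Vec n →L[ℝ] Vec n :=
  mfderiv (𝓡 n) 𝓘(ℝ, EuclideanSpace ℝ (Fin n)) (extChartAt (𝓡 n) p) q

/-- The tangent map of the inverse of the preferred chart at `p`. -/
def chartSymmDeriv (p : M) (y : Vec n) : Vec n →L[ℝ] Vec n :=
  mfderiv 𝓘(ℝ, EuclideanSpace ℝ (Fin n)) (𝓡 n) (extChartAt (𝓡 n) p).symm y

theorem inChart_apply {k : ℕ} (α : Form n M k) (p : M) (y : Vec n) (v : Fin k → Vec n) :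
    inChart α p y v = α ((extChartAt (𝓡 n) p).symm y) fun i => chartSymmDeriv p y (v i) := rfl

theorem inChart_eq {k : ℕ} (α : Form n M k) (p : M) (y : Vec n) :
    inChart α p y =
      (α ((extChartAt (𝓡 n) p).symm y)).compContinuousLinearMap (chartSymmDeriv p y) := rfl

theorem inChart_covWedge {k : ℕ} (a : M → CoVec n) (α : Form n M k) (p : M) (y : Vec n) :
    inChart (fun q => covWedge (a q) (α q)) p y =
      covWedge ((a ((extChartAt (𝓡 n) p).symm y)).comp (chartSymmDeriv p y)) (inChart α p y) :=
  covWedge_compContinuousLinearMap _ _ _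

theorem contDiffAt_comp_extChartAt_symm {f : M → ℝ} (hf : ContMDiff (𝓡 n) 𝓘(ℝ, ℝ) ∞ f) (p : M) :
    ContDiffAt ℝ ∞ (fun y => f ((extChartAt (𝓡 n) p).symm y)) (extChartAt (𝓡 n) p p) := by
  have h := (contMDiffAt_iff.1 (hf p)).2
  rw [(𝓡 n).range_eq_univ, contDiffWithinAt_univ] at h
  exact h

section Maps

variable {m : ℕ} {N : Type*} [TopologicalSpace N] [ChartedSpace (EuclideanSpace ℝ (Fin m)) N]

/-- The representation of a map in charts. -/
def mapInChart (f : M → N) (p : M) (b : N) (y : Vec n) : Vec m :=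
  extChartAt (𝓡 m) b (f ((extChartAt (𝓡 n) p).symm y))

theorem contDiffAt_mapInChart {f : M → N} (hf : ContMDiff (𝓡 n) (𝓡 m) ∞ f) (p : M) :
    ContDiffAt ℝ ∞ (mapInChart (m := m) (n := n) f p (f p)) (extChartAt (𝓡 n) p p) := by
  have h := (contMDiffAt_iff.1 (hf p)).2
  rw [(𝓡 n).range_eq_univ, contDiffWithinAt_univ] at h
  exact h

theorem eventually_mem_source {f : M → N} (hf : Continuous f) (p : M) :
    ∀ᶠ y in nhds (extChartAt (𝓡 n) p p), y ∈ (extChartAt (𝓡 n) p).target ∧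
      f ((extChartAt (𝓡 n) p).symm y) ∈ (extChartAt (𝓡 m) (f p)).source := by
  have h1 : Filter.Tendsto (fun y => f ((extChartAt (𝓡 n) p).symm y))
      (nhds (extChartAt (𝓡 n) p p)) (nhds (f p)) := by
    have h2 := (continuousAt_extChartAt_symm (I := 𝓡 n) p).tendsto
    rw [extChartAt_to_inv] at h2
    exact (hf.tendsto p).comp h2
  filter_upwards [extChartAt_target_mem_nhds (I := 𝓡 n) p,
    h1 (extChartAt_source_mem_nhds (I := 𝓡 m) (f p))] with y hy hy'
  exact ⟨hy, hy'⟩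

end Maps

variable [IsManifold (𝓡 n) ∞ M]

theorem mdifferentiableAt_extChartAt_symm {p : M} {y : Vec n}
    (hy : y ∈ (extChartAt (𝓡 n) p).target) :
    MDifferentiableAt 𝓘(ℝ, EuclideanSpace ℝ (Fin n)) (𝓡 n) (extChartAt (𝓡 n) p).symm y := by
  have : IsManifold (𝓡 n) 1 M := .of_le (n := ∞) (by exact_mod_cast le_top)
  have h := mdifferentiableWithinAt_extChartAt_symm (I := 𝓡 n) hy
  rwa [(𝓡 n).range_eq_univ, mdifferentiableWithinAt_univ] at h

theorem chartDeriv_chartSymmDeriv {p : M} {y : Vec n} (hy : y ∈ (extChartAt (𝓡 n) p).target)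
    (v : Vec n) :
    chartDeriv p ((extChartAt (𝓡 n) p).symm y) (chartSymmDeriv p y v) = v := by
  have : IsManifold (𝓡 n) 1 M := .of_le (n := ∞) (by exact_mod_cast le_top)
  have h := mfderiv_extChartAt_comp_mfderivWithin_extChartAt_symm (I := 𝓡 n) hy
  rw [(𝓡 n).range_eq_univ, mfderivWithin_univ] at h
  exact congrArg (fun L : Vec n →L[ℝ] Vec n => L v) h

theorem chartSymmDeriv_chartDeriv {p q : M} (hq : q ∈ (extChartAt (𝓡 n) p).source) (v : Vec n) :
    chartSymmDeriv p (extChartAt (𝓡 n) p q) (chartDeriv p q v) = v := by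
  have : IsManifold (𝓡 n) 1 M := .of_le (n := ∞) (by exact_mod_cast le_top)
  have h := mfderivWithin_extChartAt_symm_comp_mfderiv_extChartAt' (I := 𝓡 n) hq
  rw [(𝓡 n).range_eq_univ, mfderivWithin_univ] at h
  exact congrArg (fun L : Vec n →L[ℝ] Vec n => L v) h

/-- The tangent space at p is identified with the model space by the preferred chart at p, so at the
base point pull-backs along this chart change nothing. -/
theorem chartDeriv_self (p : M) : chartDeriv p p = ContinuousLinearMap.id ℝ (Vec n) := by
  have : IsManifold (𝓡 n) 1 M := .of_le (n := ∞) (by exact_mod_cast le_top)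
  exact mfderiv_extChartAt_self (I := 𝓡 n)

theorem chartSymmDeriv_self (p : M) :
    chartSymmDeriv p (extChartAt (𝓡 n) p p) = ContinuousLinearMap.id ℝ (Vec n) := by
  ext1 v
  have h := chartSymmDeriv_chartDeriv (mem_extChartAt_source (I := 𝓡 n) p) v
  rwa [chartDeriv_self] at h

theorem inChart_self {k : ℕ} (α : Form n M k) (p : M) : inChart α p (extChartAt (𝓡 n) p p) = α p := by
  rw [inChart_eq, chartSymmDeriv_self, extChartAt_to_inv]
  rfl

theorem extd_eq_extDeriv_inChart {k : ℕ} (α : Form n M k) (p : M) :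
    extd α p = extDeriv (inChart α p) (extChartAt (𝓡 n) p p) := by
  change (extDeriv (inChart α p) (extChartAt (𝓡 n) p p)).compContinuousLinearMap (chartDeriv p p) = _
  rw [chartDeriv_self]
  rfl

theorem fderiv_comp_extChartAt_symm {f : M → ℝ} {p : M} {y : Vec n}
    (hy : y ∈ (extChartAt (𝓡 n) p).target)
    (hf : MDifferentiableAt (𝓡 n) 𝓘(ℝ, ℝ) f ((extChartAt (𝓡 n) p).symm y)) :
    fderiv ℝ (fun z => f ((extChartAt (𝓡 n) p).symm z)) y =
      (mfderiv (𝓡 n) 𝓘(ℝ, ℝ) f ((extChartAt (𝓡 n) p).symm y) : Vec n →L[ℝ] ℝ).comp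
        (chartSymmDeriv p y) := by
  have h := mfderiv_comp y hf (mdifferentiableAt_extChartAt_symm hy)
  rw [mfderiv_eq_fderiv] at h
  exact h

theorem toCov_extd_zeroForm (f : M → ℝ) (hf : MDifferentiable (𝓡 n) 𝓘(ℝ, ℝ) f) (p : M) :
    toCov (extd (zeroForm f) p) = (mfderiv (𝓡 n) 𝓘(ℝ, ℝ) f p : Vec n →L[ℝ] ℝ) := by
  have h : inChart (zeroForm f) p = fun y => ContinuousAlternatingMap.constOfIsEmpty ℝ (Vec n) (Fin 0)
      (f ((extChartAt (𝓡 n) p).symm y)) := rfl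
  rw [extd_eq_extDeriv_inChart, h, extDeriv_constOfIsEmpty,
    fderiv_comp_extChartAt_symm (mem_extChartAt_target p) (hf _), chartSymmDeriv_self,
    extChartAt_to_inv]
  rfl

/-- The exterior derivative of `df ∧ α`. -/
theorem extd_covWedge_extd_zeroForm {k : ℕ} {f : M → ℝ} (hf : ContMDiff (𝓡 n) 𝓘(ℝ, ℝ) ∞ f)
    {α : Form n M k} {p : M} (hα : ContDiffAt ℝ ∞ (inChart α p) (extChartAt (𝓡 n) p p)) :
    extd (fun q => covWedge (toCov (extd (zeroForm f) q)) (α q)) p =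
      -covWedge (toCov (extd (zeroForm f) p)) (extd α p) := by
  have hd : MDifferentiable (𝓡 n) 𝓘(ℝ, ℝ) f := hf.mdifferentiable (by simp)
  have hev : inChart (fun q => covWedge (toCov (extd (zeroForm f) q)) (α q)) p =ᶠ[
      nhds (extChartAt (𝓡 n) p p)] fun y => covWedge
        (fderiv ℝ (fun y => f ((extChartAt (𝓡 n) p).symm y)) y) (inChart α p y) := by
    filter_upwards [extChartAt_target_mem_nhds (I := 𝓡 n) p] with y hy
    rw [inChart_covWedge, toCov_extd_zeroForm f hd, fderiv_comp_extChartAt_symm hy (hd _)]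
    rfl
  rw [extd_eq_extDeriv_inChart, hev.extDeriv_eq,
    extDeriv_covWedge_fderiv (contDiffAt_comp_extChartAt_symm hf p) hα, extd_eq_extDeriv_inChart α,
    fderiv_comp_extChartAt_symm (mem_extChartAt_target p) (hd _), chartSymmDeriv_self,
    extChartAt_to_inv, toCov_extd_zeroForm f hd]
  rfl

section Maps

variable {m : ℕ} {N : Type*} [TopologicalSpace N] [ChartedSpace (EuclideanSpace ℝ (Fin m)) N]
  [IsManifold (𝓡 m) ∞ N]

theorem fderiv_mapInChart {f : M → N} {p : M} {b : N} {y : Vec n}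
    (hy : y ∈ (extChartAt (𝓡 n) p).target)
    (hb : f ((extChartAt (𝓡 n) p).symm y) ∈ (extChartAt (𝓡 m) b).source)
    (hf : MDifferentiableAt (𝓡 n) (𝓡 m) f ((extChartAt (𝓡 n) p).symm y)) :
    fderiv ℝ (mapInChart (m := m) (n := n) f p b) y =
      (chartDeriv b (f ((extChartAt (𝓡 n) p).symm y))).comp
        ((mfderiv (𝓡 n) (𝓡 m) f ((extChartAt (𝓡 n) p).symm y) : Vec n →L[ℝ] Vec m).comp
          (chartSymmDeriv p y)) := by
  have : IsManifold (𝓡 m) 1 N := .of_le (n := ∞) (by exact_mod_cast le_top)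
  have h1 := mfderiv_comp y hf (mdifferentiableAt_extChartAt_symm hy)
  have h2 := mfderiv_comp y (mdifferentiableAt_extChartAt (I := 𝓡 m) (x := b)
    (by rwa [extChartAt_source] at hb)) (hf.comp y (mdifferentiableAt_extChartAt_symm hy))
  rw [h1, mfderiv_eq_fderiv] at h2
  exact h2

/-- The representation in charts of the pull-back of a form. -/
theorem inChart_pullback {k : ℕ} {f : M → N} {p : M} {b : N} {y : Vec n} (α : Form m N k)
    (hy : y ∈ (extChartAt (𝓡 n) p).target)
    (hb : f ((extChartAt (𝓡 n) p).symm y) ∈ (extChartAt (𝓡 m) b).source)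
    (hf : MDifferentiableAt (𝓡 n) (𝓡 m) f ((extChartAt (𝓡 n) p).symm y)) :
    inChart (fun q => (α (f q)).compContinuousLinearMap
        (mfderiv (𝓡 n) (𝓡 m) f q : Vec n →L[ℝ] Vec m)) p y =
      (inChart α b (mapInChart (n := n) f p b y)).compContinuousLinearMap
        (fderiv ℝ (mapInChart (m := m) (n := n) f p b) y) := by
  rw [fderiv_mapInChart hy hb hf]
  ext v
  have h : (extChartAt (𝓡 m) b).symm (mapInChart f p b y) = f ((extChartAt (𝓡 n) p).symm y) :=
    (extChartAt (𝓡 m) b).left_inv hb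
  rw [inChart_eq, inChart_eq, h]
  change α _ _ = α _ _
  congr 1
  funext i
  exact (chartSymmDeriv_chartDeriv hb _).symm

end Maps

/-- The exterior derivative can be computed in every preferred chart. -/
theorem extd_eq_of_mem_source {k : ℕ} (α : Form n M k) {p q : M}
    (hq : q ∈ (extChartAt (𝓡 n) p).source)
    (hα : DifferentiableAt ℝ (inChart α p) (extChartAt (𝓡 n) p q)) :
    extd α q = (extDeriv (inChart α p) (extChartAt (𝓡 n) p q)).compContinuousLinearMap
      (chartDeriv p q) := by
  have hid : Continuous (id : M → M) := continuous_id
  have hmd : ∀ x : M, MDifferentiableAt (𝓡 n) (𝓡 n) (id : M → M) x := fun x => mdifferentiableAt_id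
  have hsrc : (extChartAt (𝓡 n) p).source ∈ nhds q :=
    (isOpen_extChartAt_source (I := 𝓡 n) p).mem_nhds hq
  -- The change of charts is the identity map read in the charts at q and p, so naturality of the
  -- exterior derivative under pull-back applies.
  have hev : inChart α q =ᶠ[nhds (extChartAt (𝓡 n) q q)] fun y =>
      (inChart α p (mapInChart (n := n) (id : M → M) q p y)).compContinuousLinearMap
        (fderiv ℝ (mapInChart (m := n) (n := n) (id : M → M) q p) y) := by
    have h2 := (continuousAt_extChartAt_symm (I := 𝓡 n) q).tendsto
    rw [extChartAt_to_inv] at h2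
    filter_upwards [extChartAt_target_mem_nhds (I := 𝓡 n) q, h2 hsrc] with y hy hy'
    rw [← inChart_pullback (f := id) α hy hy' (hmd _)]
    simp only [mfderiv_id]
    rfl
  have hsm : ContDiffAt ℝ ∞ (mapInChart (m := n) (n := n) (id : M → M) q p) (extChartAt (𝓡 n) q q) := by
    have h := contDiffWithinAt_ext_coord_change (I := 𝓡 n) (n := ∞) p q
      (y := extChartAt (𝓡 n) q q) (by simpa using hq)
    rwa [(𝓡 n).range_eq_univ, contDiffWithinAt_univ] at h
  have hpt : mapInChart (m := n) (n := n) (id : M → M) q p (extChartAt (𝓡 n) q q) = extChartAt (𝓡 n) p q := by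
    simp [mapInChart]
  rw [extd_eq_extDeriv_inChart, hev.extDeriv_eq, extDeriv_pullback (by rwa [hpt]) hsm
    (by rw [minSmoothness_of_isRCLikeNormedField]; exact WithTop.coe_le_coe.2 le_top), hpt,
    fderiv_mapInChart (mem_extChartAt_target q) (by simpa using hq) (hmd _), chartSymmDeriv_self,
    mfderiv_id]
  simp only [extChartAt_to_inv]
  rfl

end Charts

section

/-! ### The exterior derivative of the contraction of the volume form -/

section Algebra

variable {n : ℕ}

theorem covWedge_apply_two (c : CoVec n) (α : Alt n 1) (x y : Vec n) :
    covWedge c α ![x, y] = c x * toCov α y - c y * toCov α x := by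
  rw [covWedge_apply, Fin.sum_univ_two, apply_eq_toCov, apply_eq_toCov]
  simp [Fin.removeNth]
  ring

theorem area_apply (A : Alt 2 2) (x y : Vec 2) :
    A ![x, y] = A basisVec * (x 0 * y 1 - x 1 * y 0) := by
  have h := AlternatingMap.eq_smul_basis_det (EuclideanSpace.basisFun (Fin 2) ℝ).toBasis
    A.toAlternatingMap
  have h2 := congrArg (fun f => f ![x, y]) h
  have h3 : ⇑(EuclideanSpace.basisFun (Fin 2) ℝ).toBasis = basisVec := by
    funext i
    simp [basisVec]
  simp only [h3, AlternatingMap.smul_apply, Module.Basis.det_apply, smul_eq_mul,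
    Matrix.det_fin_two, Module.Basis.toMatrix_apply] at h2
  refine Eq.trans h2 ?_
  simp
  left
  ring

/-- An area form is its coefficient times dx ∧ dy, and β commutes with a 2-form. Placing the closed
factors dx, dy in front lets d pass through them directly. -/
theorem covWedge_area_comp (β : Alt n 1) (A : Alt 2 2) (L : Vec n →L[ℝ] Vec 2) :
    covWedge (toCov β) (A.compContinuousLinearMap L) =
      covWedge ((basisCoVec 0).comp L) (covWedge ((basisCoVec 1).comp L) (A basisVec • β)) := by
  have hA : ∀ x y : Vec n, A.compContinuousLinearMap L ![x, y] =
      A basisVec * (L x 0 * L y 1 - L x 1 * L y 0) := by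
    intro x y
    rw [← area_apply]
    change A _ = A _
    congr 1
    funext i
    fin_cases i <;> rfl
  have hs : ∀ x, toCov (A basisVec • β) x = A basisVec * toCov β x := fun _ => rfl
  ext v
  rw [covWedge_apply_three, covWedge_apply_three]
  simp only [covWedge_apply_two, hA, hs, ContinuousLinearMap.comp_apply, basisCoVec_apply]
  ring

end Algebra

section EndoInChart

variable {n : ℕ} {M : Type*} [TopologicalSpace M] [ChartedSpace (EuclideanSpace ℝ (Fin n)) M]

theorem SmoothForm.contDiffAt {k : ℕ} {α : Form n M k} (hα : SmoothForm α) (p : M) :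
    ContDiffAt ℝ ∞ (inChart α p) (extChartAt (𝓡 n) p p) :=
  (hα p).contDiffAt (extChartAt_target_mem_nhds (I := 𝓡 n) p)

variable [IsManifold (𝓡 n) ∞ M]

/-- The representation of a field of endomorphisms in a chart. -/
def endoInChart (g : M → Vec n →L[ℝ] Vec n) (p : M) (y : Vec n) : Vec n →L[ℝ] Vec n :=
  (chartDeriv p ((extChartAt (𝓡 n) p).symm y)).comp
    ((g ((extChartAt (𝓡 n) p).symm y)).comp (chartSymmDeriv p y))

theorem trivializationAt_continuousLinearMapAt_apply {p q : M}
    (hq : q ∈ (extChartAt (𝓡 n) p).source) (v : Vec n) :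
    (trivializationAt (EuclideanSpace ℝ (Fin n)) (TangentSpace (𝓡 n)) p).continuousLinearMapAt ℝ q v =
      chartDeriv p q v := by
  have : IsManifold (𝓡 n) 1 M := .of_le (n := ∞) (by exact_mod_cast le_top)
  rw [extChartAt_source] at hq
  rw [TangentBundle.continuousLinearMapAt_trivializationAt (I := 𝓡 n) hq]
  rfl

theorem trivializationAt_symmL_apply {p q : M}
    (hq : q ∈ (extChartAt (𝓡 n) p).source) (v : Vec n) :
    (trivializationAt (EuclideanSpace ℝ (Fin n)) (TangentSpace (𝓡 n)) p).symmL ℝ q v =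
      chartSymmDeriv p (extChartAt (𝓡 n) p q) v := by
  have : IsManifold (𝓡 n) 1 M := .of_le (n := ∞) (by exact_mod_cast le_top)
  rw [extChartAt_source] at hq
  rw [TangentBundle.symmL_trivializationAt (I := 𝓡 n) hq, (𝓡 n).range_eq_univ, mfderivWithin_univ]
  rfl

/-- The trivialisation of the endomorphism bundle at p conjugates with the tangent maps of the
preferred chart and its inverse. -/
theorem contDiffAt_endoInChart_apply {g : M → Vec n →L[ℝ] Vec n} (hg : SmoothEndo g) (p : M) (v : Vec n) :
    ContDiffAt ℝ ∞ (fun y => endoInChart g p y v) (extChartAt (𝓡 n) p p) := by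
  have : IsManifold (𝓡 n) 1 M := .of_le (n := ∞) (by exact_mod_cast le_top)
  have h := ((contMDiffAt_hom_bundle _).1 (hg p)).2
  have h2 := (contMDiffAt_iff.1 h).2
  rw [(𝓡 n).range_eq_univ, contDiffWithinAt_univ] at h2
  have h3 := h2.clm_apply (contDiffAt_const (c := v))
  refine ContDiffAt.congr_of_eventuallyEq h3 ?_
  filter_upwards [extChartAt_target_mem_nhds (I := 𝓡 n) p] with y hy
  have hsrc := (extChartAt (𝓡 n) p).map_target hy
  have h4 := trivializationAt_symmL_apply hsrc v
  have h5 := trivializationAt_continuousLinearMapAt_apply hsrc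
    (g ((extChartAt (𝓡 n) p).symm y) (chartSymmDeriv p y v))
  rw [(extChartAt (𝓡 n) p).right_inv hy] at h4
  refine h5.symm.trans ?_
  rw [← h4]
  rfl

end EndoInChart

/-! ### Ω^H, Ω^V and σ in charts -/

variable {M B : Type*}
  [TopologicalSpace M] [ChartedSpace (EuclideanSpace ℝ (Fin 5)) M]
  [TopologicalSpace B] [ChartedSpace (EuclideanSpace ℝ (Fin 2)) B]

section Fibration

variable (F : OrientedFibration M B) (p : M)

/-- The representation of the projection in charts. -/
def OrientedFibration.projInChart (y : Vec 5) : Vec 2 :=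
  mapInChart (n := 5) (m := 2) F.proj p (F.proj p) y

/-- The representation of the area form in charts, pulled back to the chart of the total space. -/
def OrientedFibration.areaInChart (y : Vec 5) : Alt 2 2 :=
  inChart F.area (F.proj p) (F.projInChart p y)

theorem OrientedFibration.projInChart_self :
    F.projInChart p (extChartAt (𝓡 5) p p) = extChartAt (𝓡 2) (F.proj p) (F.proj p) := by
  rw [OrientedFibration.projInChart, mapInChart, extChartAt_to_inv]

theorem OrientedFibration.contDiffAt_projInChart :
    ContDiffAt ℝ ∞ (F.projInChart p) (extChartAt (𝓡 5) p p) :=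
  contDiffAt_mapInChart F.proj_smooth p

theorem OrientedFibration.contDiffAt_areaInChart :
    ContDiffAt ℝ ∞ (F.areaInChart p) (extChartAt (𝓡 5) p p) := by
  refine ContDiffAt.comp _ ?_ (F.contDiffAt_projInChart p)
  rw [F.projInChart_self]
  exact F.area_smooth.contDiffAt _

variable [IsManifold (𝓡 2) ∞ B]

theorem OrientedFibration.areaInChart_self :
    F.areaInChart p (extChartAt (𝓡 5) p p) = F.area (F.proj p) := by
  rw [OrientedFibration.areaInChart, F.projInChart_self, inChart_self]

variable [IsManifold (𝓡 5) ∞ M]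

theorem OrientedFibration.fderiv_projInChart_self :
    fderiv ℝ (F.projInChart p) (extChartAt (𝓡 5) p p) = F.dproj p := by
  refine (fderiv_mapInChart (mem_extChartAt_target p) ?_ (F.proj_smooth.mdifferentiable (by simp) _)).trans ?_
  · rw [extChartAt_to_inv]
    exact mem_extChartAt_source _
  · rw [extChartAt_to_inv, chartSymmDeriv_self, chartDeriv_self]
    rfl

theorem OrientedFibration.inChart_volH_eventuallyEq :
    inChart F.volH p =ᶠ[nhds (extChartAt (𝓡 5) p p)] fun y =>
      (F.areaInChart p y).compContinuousLinearMap (fderiv ℝ (F.projInChart p) y) := by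
  filter_upwards [eventually_mem_source (n := 5) (m := 2) F.proj_smooth.continuous p] with y hy
  exact inChart_pullback F.area hy.1 hy.2 (F.proj_smooth.mdifferentiable (by simp) _)

theorem OrientedFibration.contDiffAt_inChart_volH :
    ContDiffAt ℝ ∞ (inChart F.volH p) (extChartAt (𝓡 5) p p) := by
  refine ContDiffAt.congr_of_eventuallyEq ?_ (F.inChart_volH_eventuallyEq p)
  refine contDiffAt_alt_of_apply fun v => ?_
  exact contDiffAt_alt_apply (v := fun i y => fderiv ℝ (F.projInChart p) y (v i))
    (F.contDiffAt_areaInChart p) fun i =>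
    ((F.contDiffAt_projInChart p).fderiv_right (m := ∞) (by simp)).clm_apply contDiffAt_const

end Fibration

namespace Setup

variable [IsManifold (𝓡 5) ∞ M] {F : OrientedFibration M B} (T : Setup F) (p : M)

theorem inChart_volH_mul_inChart_volV {y : Vec 5} (hy : y ∈ (extChartAt (𝓡 5) p).target)
    (x : Fin 2 → Vec 5) (v : Fin 3 → Vec 5) :
    inChart F.volH p y x * inChart T.volV p y v =
      inChart F.vol p y ![x 0, x 1, endoInChart T.conn p y (v 0), endoInChart T.conn p y (v 1),
        endoInChart T.conn p y (v 2)] := by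
  have hE : ∀ z, chartSymmDeriv p y (endoInChart T.conn p y z) =
      T.conn ((extChartAt (𝓡 5) p).symm y) (chartSymmDeriv p y z) := by
    intro z
    have h := chartSymmDeriv_chartDeriv ((extChartAt (𝓡 5) p).map_target hy)
      (T.conn ((extChartAt (𝓡 5) p).symm y) (chartSymmDeriv p y z))
    rwa [(extChartAt (𝓡 5) p).right_inv hy] at h
  rw [inChart_apply, inChart_apply, inChart_apply, volH_mul_volV]
  congr 1
  funext i
  fin_cases i
  · rfl
  · rfl
  · exact (hE _).symm
  · exact (hE _).symm
  · exact (hE _).symm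

variable [IsManifold (𝓡 2) ∞ B]

/-- Freeze the horizontal frame at p as constant vectors in the chart. Ω^H stays nonzero on them
nearby, so `inChart_volH_mul_inChart_volV` shows the components of Ω^V as quotients of smooth
functions. -/
theorem contDiffAt_inChart_volV :
    ContDiffAt ℝ ∞ (inChart T.volV p) (extChartAt (𝓡 5) p p) := by
  refine contDiffAt_alt_of_apply fun v => ?_
  have h1 : ContDiffAt ℝ ∞ (fun y => inChart F.volH p y (T.horFrame p)) (extChartAt (𝓡 5) p p) :=
    contDiffAt_alt_apply (F.contDiffAt_inChart_volH p) fun i => contDiffAt_const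
  have h0 : inChart F.volH p (extChartAt (𝓡 5) p p) (T.horFrame p) ≠ 0 := by
    rw [inChart_self, volH_horFrame]
    exact F.areaCoeff_ne_zero _
  have hg : ∀ z, ContDiffAt ℝ ∞ (fun y => endoInChart T.conn p y z) (extChartAt (𝓡 5) p p) :=
    fun z => contDiffAt_endoInChart_apply T.conn_smooth p z
  have h2 : ContDiffAt ℝ ∞ (fun y => inChart F.vol p y fun i => (![fun _ => T.horFrame p 0,
      fun _ => T.horFrame p 1, fun y => endoInChart T.conn p y (v 0),
      fun y => endoInChart T.conn p y (v 1), fun y => endoInChart T.conn p y (v 2)] :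
        Fin 5 → Vec 5 → Vec 5) i y) (extChartAt (𝓡 5) p p) := by
    refine contDiffAt_alt_apply (F.vol_smooth.contDiffAt p) fun i => ?_
    fin_cases i
    · exact contDiffAt_const
    · exact contDiffAt_const
    · exact hg _
    · exact hg _
    · exact hg _
  refine (h2.div h1 h0).congr_of_eventuallyEq ?_
  filter_upwards [extChartAt_target_mem_nhds (I := 𝓡 5) p,
    h1.continuousAt.eventually_ne h0] with y hy hy0
  rw [Pi.div_apply, eq_div_iff hy0, mul_comm, T.inChart_volH_mul_inChart_volV p hy]
  congr 1
  funext i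
  fin_cases i <;> rfl

theorem inChart_sigma_eventuallyEq :
    inChart T.sigma p =ᶠ[nhds (extChartAt (𝓡 5) p p)] fun y =>
      (-T.kappa ((extChartAt (𝓡 5) p).symm y)) • inChart T.volV p y +
        covWedge (fderiv ℝ (fun z => F.projInChart p z 0) y)
          (covWedge (fderiv ℝ (fun z => F.projInChart p z 1) y)
            ((-F.areaInChart p y basisVec) • inChart T.beta p y)) := by
  have h1 : (1 : WithTop ℕ∞) ≤ ∞ := by exact_mod_cast le_top
  filter_upwards [F.inChart_volH_eventuallyEq p,
    ((F.contDiffAt_projInChart p).of_le h1).eventually (by simp)] with y hy hd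
  have hσ : inChart T.sigma p y = -(T.kappa ((extChartAt (𝓡 5) p).symm y) • inChart T.volV p y) -
      covWedge (toCov (inChart T.beta p y)) (inChart F.volH p y) := by
    rw [← show _ = covWedge (toCov (inChart T.beta p y)) (inChart F.volH p y) from
      inChart_covWedge (fun q => toCov (T.beta q)) F.volH p y]
    rfl
  have hf : ∀ i, fderiv ℝ (fun z => F.projInChart p z i) y =
      (basisCoVec i).comp (fderiv ℝ (F.projInChart p) y) := fun i =>
    ((basisCoVec i).hasFDerivAt.comp y (hd.differentiableAt one_ne_zero).hasFDerivAt).fderiv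
  rw [hσ, hy, covWedge_area_comp, hf, hf]
  ext v
  simp only [covWedge_smul, ContinuousAlternatingMap.sub_apply, ContinuousAlternatingMap.add_apply,
    ContinuousAlternatingMap.neg_apply, ContinuousAlternatingMap.smul_apply, smul_eq_mul]
  ring

theorem contDiffAt_inChart_sigma :
    ContDiffAt ℝ ∞ (inChart T.sigma p) (extChartAt (𝓡 5) p p) := by
  refine ContDiffAt.congr_of_eventuallyEq ?_ (T.inChart_sigma_eventuallyEq p)
  have hf : ∀ i, ContDiffAt ℝ ∞ (fderiv ℝ (fun z => F.projInChart p z i)) (extChartAt (𝓡 5) p p) :=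
    fun i => ((basisCoVec i).contDiff.contDiffAt.comp _ (F.contDiffAt_projInChart p)).fderiv_right
      (m := ∞) (by simp)
  have hw : ContDiffAt ℝ ∞ (fun y => (-F.areaInChart p y basisVec) • inChart T.beta p y)
      (extChartAt (𝓡 5) p p) :=
    (contDiffAt_alt_apply (F.contDiffAt_areaInChart p) fun i => contDiffAt_const).neg.smul
      (T.beta_smooth.contDiffAt p)
  exact ((contDiffAt_comp_extChartAt_symm T.kappa_smooth p).neg.smul
    (T.contDiffAt_inChart_volV p)).add (contDiffAt_covWedge (hf 0) (contDiffAt_covWedge (hf 1) hw))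

/-- Leibniz rule on the local expression of σ, passing d through dx and dy at the cost of two signs.
The covector `dw` depends on the chart of B; all that matters is that it kills vertical vectors. -/
theorem extd_sigma :
    ∃ dw : CoVec 5, (∀ x, F.dproj p x = 0 → dw x = 0) ∧ extd T.sigma p =
      -(covWedge (toCov (extd (zeroForm T.kappa) p)) (T.volV p) + T.kappa p • extd T.volV p) -
        covWedge ((basisCoVec 0).comp (F.dproj p)) (covWedge ((basisCoVec 1).comp (F.dproj p))
          (covWedge dw (T.beta p) + F.areaCoeff (F.proj p) • extd T.beta p)) := by
  set y₀ := extChartAt (𝓡 5) p p with hy₀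
  have hi : (∞ : WithTop ℕ∞) ≠ 0 := by simp
  have hpr := F.contDiffAt_projInChart p
  have hc : ∀ i, ContDiffAt ℝ ∞ (fun z => F.projInChart p z i) y₀ :=
    fun i => (basisCoVec i).contDiff.contDiffAt.comp _ hpr
  have hf : ∀ i, fderiv ℝ (fun z => F.projInChart p z i) y₀ = (basisCoVec i).comp (F.dproj p) := by
    intro i
    rw [← F.fderiv_projInChart_self]
    exact ((basisCoVec i).hasFDerivAt.comp y₀ (hpr.differentiableAt hi).hasFDerivAt).fderiv
  have hw : ContDiffAt ℝ ∞ (fun y => F.areaInChart p y basisVec) y₀ :=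
    contDiffAt_alt_apply (F.contDiffAt_areaInChart p) fun i => contDiffAt_const
  have hβ := T.beta_smooth.contDiffAt p
  have hV := T.contDiffAt_inChart_volV p
  have hκ := contDiffAt_comp_extChartAt_symm T.kappa_smooth p
  have hfc : ∀ i, ContDiffAt ℝ ∞ (fderiv ℝ (fun z => F.projInChart p z i)) y₀ :=
    fun i => (hc i).fderiv_right (m := ∞) (by simp)
  have hwβ : ContDiffAt ℝ ∞ (fun y => (-F.areaInChart p y basisVec) • inChart T.beta p y) y₀ :=
    hw.neg.smul hβ
  have hκV : ContDiffAt ℝ ∞ (fun y => (-T.kappa ((extChartAt (𝓡 5) p).symm y)) •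
      inChart T.volV p y) y₀ := hκ.neg.smul hV
  -- The area coefficient is pulled back from the base, so its differential factors through dπ.
  refine ⟨fderiv ℝ (fun y => F.areaInChart p y basisVec) y₀, fun x hx => ?_, ?_⟩
  · have ha : ContDiffAt ℝ ∞ (fun z => inChart F.area (F.proj p) z basisVec) (F.projInChart p y₀) := by
      rw [F.projInChart_self]
      exact contDiffAt_alt_apply (F.area_smooth.contDiffAt _) fun i => contDiffAt_const
    have h := ((ha.differentiableAt hi).hasFDerivAt.comp y₀ (hpr.differentiableAt hi).hasFDerivAt).fderiv
    change fderiv ℝ (fun y => F.areaInChart p y basisVec) y₀ = _ at h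
    rw [h, F.fderiv_projInChart_self, ContinuousLinearMap.comp_apply, hx, map_zero]
  · have hd : MDifferentiable (𝓡 5) 𝓘(ℝ, ℝ) T.kappa := T.kappa_smooth.mdifferentiable (by simp)
    have hdκ : fderiv ℝ (fun y => T.kappa ((extChartAt (𝓡 5) p).symm y)) y₀ =
        toCov (extd (zeroForm T.kappa) p) := by
      rw [toCov_extd_zeroForm _ hd, fderiv_comp_extChartAt_symm (mem_extChartAt_target p) (hd _),
        chartSymmDeriv_self, extChartAt_to_inv]
      rfl
    rw [extd_eq_extDeriv_inChart, (T.inChart_sigma_eventuallyEq p).extDeriv_eq,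
      extDeriv_fun_add (hκV.differentiableAt hi)
        ((contDiffAt_covWedge (hfc 0) (contDiffAt_covWedge (hfc 1) hwβ)).differentiableAt hi),
      extDeriv_smul_fun (hκ.neg.differentiableAt hi) (hV.differentiableAt hi),
      extDeriv_covWedge_fderiv (hc 0) (contDiffAt_covWedge (hfc 1) hwβ),
      extDeriv_covWedge_fderiv (hc 1) hwβ,
      extDeriv_smul_fun (hw.neg.differentiableAt hi) (hβ.differentiableAt hi), fderiv_fun_neg,
      fderiv_fun_neg, hf, hf, hdκ, ← extd_eq_extDeriv_inChart, ← extd_eq_extDeriv_inChart,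
      inChart_self, inChart_self, F.areaInChart_self, extChartAt_to_inv]
    have hneg : ∀ {k : ℕ} (a : CoVec 5) (α : Alt 5 k), covWedge (-a) α = -covWedge a α :=
      fun a α => by ext v; simp [covWedge_apply, Finset.sum_neg_distrib]
    simp only [hneg, neg_smul, covWedge_neg, neg_neg, covWedge_add, neg_add]
    rw [sub_eq_add_neg, neg_add]
    rfl

/-- The contraction of the volume form with `Z_{1,0} + Z_{0,1}`. -/
theorem curryLeft_Z : (F.vol p).curryLeft (T.Z10 p + T.Z01 p) = -extd T.sigma p := by
  obtain ⟨dw, hdw, h⟩ := T.extd_sigma p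
  exact T.curryLeft_Z_of_extd_sigma p dw hdw h

end Setup

end

section

/-! ### The modular vector field -/

theorem apply_basisVec_ne_zero {n : ℕ} {τ : Alt n n} (h : τ ≠ 0) : τ basisVec ≠ 0 := by
  intro h0
  refine h (eq_zero_of_basis (EuclideanSpace.basisFun (Fin n) ℝ).toBasis τ ?_)
  rw [← h0]
  congr 1
  funext i
  simp [basisVec]

section Fields

variable {n : ℕ} {M : Type*} [TopologicalSpace M] [ChartedSpace (EuclideanSpace ℝ (Fin n)) M]
  [IsManifold (𝓡 n) ∞ M]

theorem smoothField_of_contDiffAt {X : Field n M}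
    (h : ∀ p, ContDiffAt ℝ ∞ (fun y => chartDeriv p ((extChartAt (𝓡 n) p).symm y)
      (X ((extChartAt (𝓡 n) p).symm y))) (extChartAt (𝓡 n) p p)) : SmoothField X := by
  have : IsManifold (𝓡 n) 1 M := .of_le (n := ∞) (by exact_mod_cast le_top)
  intro p
  refine Bundle.contMDiffAt_totalSpace.2 ⟨contMDiffAt_id, ?_⟩
  refine ((h p).contMDiffAt.comp p contMDiffAt_extChartAt).congr_of_eventuallyEq ?_
  filter_upwards [extChartAt_source_mem_nhds (I := 𝓡 n) p] with q hq
  have h1 := trivializationAt_continuousLinearMapAt_apply hq (X q)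
  rw [Bundle.Trivialization.continuousLinearMapAt_apply,
    Bundle.Trivialization.coe_linearMapAt_of_mem _ (by simpa using hq)] at h1
  refine h1.trans ?_
  rw [Function.comp_apply, (extChartAt (𝓡 n) p).left_inv hq]

/-- Smooth functions have arbitrary differentials at a point. -/
theorem exists_smooth_mfderiv_eq [T2Space M] (p : M) (c : CoVec n) :
    ∃ f : M → ℝ, ContMDiff (𝓡 n) 𝓘(ℝ, ℝ) ∞ f ∧
      (mfderiv (𝓡 n) 𝓘(ℝ, ℝ) f p : Vec n →L[ℝ] ℝ) = c := by
  -- Cut off c composed with the chart at p; the cut-off equals 1 near p and does not affect the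
  -- differential there.
  obtain ⟨χ⟩ : Nonempty (SmoothBumpFunction (𝓡 n) p) := inferInstance
  have hc : ContMDiffOn (𝓡 n) 𝓘(ℝ, ℝ) ∞ (fun q => c (extChartAt (𝓡 n) p q))
      (chartAt (EuclideanSpace ℝ (Fin n)) p).source :=
    c.contMDiff.comp_contMDiffOn (contMDiffOn_extChartAt (I := 𝓡 n))
  refine ⟨fun q => χ q • c (extChartAt (𝓡 n) p q), χ.contMDiff_smul hc, ?_⟩
  have hev : (fun q => χ q • c (extChartAt (𝓡 n) p q)) =ᶠ[nhds p]
      fun q => c (extChartAt (𝓡 n) p q) := by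
    filter_upwards [χ.eventuallyEq_one] with q hq
    rw [hq, Pi.one_apply, one_smul]
  have h1 : MDifferentiableAt (𝓡 n) 𝓘(ℝ, EuclideanSpace ℝ (Fin n)) (extChartAt (𝓡 n) p) p :=
    mdifferentiableAt_extChartAt (I := 𝓡 n) (mem_chart_source _ p)
  have h2 := mfderiv_comp p c.mdifferentiableAt h1
  rw [hev.mfderiv_eq]
  refine h2.trans ?_
  rw [c.mfderiv_eq]
  change c.comp (chartDeriv p p) = c
  rw [chartDeriv_self, ContinuousLinearMap.comp_id]

end Fields

variable {M B : Type*}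
  [TopologicalSpace M] [ChartedSpace (EuclideanSpace ℝ (Fin 5)) M]
  [TopologicalSpace B] [ChartedSpace (EuclideanSpace ℝ (Fin 2)) B]
  [IsManifold (𝓡 5) ∞ M] [IsManifold (𝓡 2) ∞ B]

namespace Setup

variable {F : OrientedFibration M B} (T : Setup F) (p : M)

/-- L_{Π^♯df} Ω = d(df ∧ σ) = -df ∧ dσ = df ∧ i_Z Ω = (Zf) Ω. -/
theorem divergence_sharp_tensor {f : M → ℝ} (hf : ContMDiff (𝓡 5) 𝓘(ℝ, ℝ) ∞ f) :
    divergence F.vol (sharp T.tensor (extd (zeroForm f))) p =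
      (mfderiv (𝓡 5) 𝓘(ℝ, ℝ) f p : Vec 5 →L[ℝ] ℝ) (T.Z10 p + T.Z01 p) := by
  have h1 : (fun q => (F.vol q).curryLeft (sharp T.tensor (extd (zeroForm f)) q)) =
      fun q => covWedge (toCov (extd (zeroForm f) q)) (T.sigma q) :=
    funext fun q => T.curryLeft_sharp_tensor q _
  have h2 : lieDeriv (k := 4) (sharp T.tensor (extd (zeroForm f))) F.vol p =
      covWedge (toCov (extd (zeroForm f) p)) ((F.vol p).curryLeft (T.Z10 p + T.Z01 p)) := by
    rw [lieDeriv, eq_zero_of_finrank_lt (by norm_num) (extd F.vol p), h1,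
      extd_covWedge_extd_zeroForm hf (T.contDiffAt_inChart_sigma p), T.curryLeft_Z, covWedge_neg]
    ext v
    simp
  rw [divergence, h2, covWedge_curryLeft_top (by norm_num),
    toCov_extd_zeroForm f (hf.mdifferentiable (by simp)),
    mul_div_cancel_right₀ _ (apply_basisVec_ne_zero (F.vol_ne_zero p))]
  rfl

/-- In the chart at p, wedging i_Z Ω = -dσ with the i-th coordinate covector gives the i-th
coordinate of Z times the density of Ω, so dividing by that density suffices. -/
theorem smoothField_Z : SmoothField fun p => T.Z10 p + T.Z01 p := by
  refine smoothField_of_contDiffAt fun p => ?_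
  have hσ := T.contDiffAt_inChart_sigma p
  have hv := F.vol_smooth.contDiffAt p
  have hb : ContDiffAt ℝ ∞ (fun y => inChart F.vol p y basisVec) (extChartAt (𝓡 5) p p) :=
    contDiffAt_alt_apply hv fun i => contDiffAt_const
  have hb0 : inChart F.vol p (extChartAt (𝓡 5) p p) basisVec ≠ 0 := by
    rw [inChart_self]
    exact apply_basisVec_ne_zero (F.vol_ne_zero p)
  have h1 : (1 : WithTop ℕ∞) ≤ ∞ := by exact_mod_cast le_top
  rw [contDiffAt_euclidean]
  intro i
  have hc : ContDiffAt ℝ ∞ (fun y => covWedge (basisCoVec i) (extDeriv (inChart T.sigma p) y) basisVec)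
      (extChartAt (𝓡 5) p p) :=
    contDiffAt_alt_apply (contDiffAt_covWedge contDiffAt_const (contDiffAt_extDeriv hσ))
      fun i => contDiffAt_const
  refine (hc.neg.div hb hb0).congr_of_eventuallyEq ?_
  filter_upwards [extChartAt_target_mem_nhds (I := 𝓡 5) p, hb.continuousAt.eventually_ne hb0,
    (hσ.of_le h1).eventually (by simp)] with y hy hy0 hyd
  set q := (extChartAt (𝓡 5) p).symm y with hq
  have hqs : q ∈ (extChartAt (𝓡 5) p).source := (extChartAt (𝓡 5) p).map_target hy
  have hqy : extChartAt (𝓡 5) p q = y := (extChartAt (𝓡 5) p).right_inv hy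
  -- `extd` at q is defined through the chart at q; here it is moved to the fixed chart at p.
  have hd := extd_eq_of_mem_source T.sigma hqs (by rw [hqy]; exact hyd.differentiableAt one_ne_zero)
  have hz : (inChart F.vol p y).curryLeft (chartDeriv p q (T.Z10 q + T.Z01 q)) =
      -extDeriv (inChart T.sigma p) y := by
    ext w
    have h2 := congrArg (fun a : Alt 5 4 => a fun i => chartSymmDeriv p y (w i)) (T.curryLeft_Z q)
    simp only [hd, hqy, ContinuousAlternatingMap.neg_apply] at h2
    refine Eq.trans ?_ (h2.trans (congrArg Neg.neg ?_))
    · change F.vol q _ = F.vol q _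
      congr 1
      funext i
      refine Fin.cases ?_ (fun j => rfl) i
      have h3 := chartSymmDeriv_chartDeriv hqs (T.Z10 q + T.Z01 q)
      rw [hqy] at h3
      exact h3
    · change extDeriv (inChart T.sigma p) y _ = extDeriv (inChart T.sigma p) y _
      congr 1
      funext i
      exact chartDeriv_chartSymmDeriv hy (w i)
  have h4 := covWedge_curryLeft_top (by norm_num) (basisCoVec i) (inChart F.vol p y)
    (chartDeriv p q (T.Z10 q + T.Z01 q)) basisVec
  rw [hz, covWedge_neg] at h4
  rw [Pi.div_apply, eq_div_iff hy0]
  exact h4.symm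

theorem isModularVectorField_Z :
    IsModularVectorField F.vol T.tensor fun p => T.Z10 p + T.Z01 p :=
  ⟨T.smoothField_Z, fun _ hf p => (T.divergence_sharp_tensor p hf).symm⟩

/-- The i-th coordinate at p is recovered by a test function whose differential at p is the i-th
coordinate covector. -/
theorem eq_of_isModularVectorField [T2Space M] {Z : Field 5 M}
    (hZ : IsModularVectorField F.vol T.tensor Z) : Z = fun p => T.Z10 p + T.Z01 p := by
  funext p
  refine PiLp.ext fun i => ?_
  obtain ⟨f, hf, hfi⟩ := exists_smooth_mfderiv_eq p (basisCoVec i : CoVec 5)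
  have h := hZ.2 f hf p
  rw [T.divergence_sharp_tensor p hf, hfi] at h
  exact h

end Setup

end

end AlmostCoupling

end

theorem mainTheorem6 {M B : Type*}
    [TopologicalSpace M] [T2Space M] [ChartedSpace (EuclideanSpace ℝ (Fin 5)) M]
    [IsManifold (𝓡 5) ∞ M]
    [TopologicalSpace B] [ChartedSpace (EuclideanSpace ℝ (Fin 2)) B]
    [IsManifold (𝓡 2) ∞ B]
    (F : AlmostCoupling.OrientedFibration M B) (T : AlmostCoupling.Setup F)
    (hT : T.IsPoissonTriple) :
    (∃! Z : AlmostCoupling.Field 5 M,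
      AlmostCoupling.IsModularVectorField F.vol T.tensor Z) ∧
    ∀ Z : AlmostCoupling.Field 5 M, AlmostCoupling.IsModularVectorField F.vol T.tensor Z →
      ∀ p : M, Z p = T.Z10 p + T.Z01 p ∧
        T.conn p (T.Z10 p) = 0 ∧ F.dproj p (T.Z01 p) = 0 :=
  ⟨⟨_, T.isModularVectorField_Z, fun _ hZ => T.eq_of_isModularVectorField hZ⟩, fun _ hZ p =>
    ⟨congrFun (T.eq_of_isModularVectorField hZ) p, T.conn_Z10 p, T.dproj_Z01 p⟩⟩
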